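/- Let $d\ge 1$ and $N\ge 2$ be integers, and let $(c_1,c_2,c_3,\dots)$ be a nonincreasing sequence of numbers in $[0,1]$. Then there exist a probability space $(\Omega,\mathcal F,P)$ and on it a strictly stationary field $X=(X_k,\ k\in\mathbb Z^d)$ of real random variables such that: (A) $X_{\mathbf 0}$ is uniformly distributed on $[0,1]$; (B) for all distinct $k(1),\dots,k(N)\in\mathbb Z^d$, the random variables $X_{k(1)},\dots,X_{k(N)}$ are independent ($X$ is $N$-tuplewise independent); (C) for every integer $n\ge 1$, $\;4\alpha(n)=\rho(n)=\rho'(n)=\rho^*(n)=c_n$. Here strict stationarity means that for each $v\in\mathbb Z^d$ the fields $(X_{k+v},\ k\in\mathbb Z^d)$ and $(X_k,\ k\in\mathbb Z^d)$ have the same distribution on $\mathbb R^{\mathbb Z^d}$. For $\sigma$-fields $\mathcal A,\mathcal B\subset\mathcal F$, $$\alpha(\mathcal A,\mathcal B)=\sup_{A\in\mathcal A,\,B\in\mathcal B}|P(A\cap B)-P(A)P(B)|,\qquad \rho(\mathcal A,\mathcal B)=\sup_{f,g}|\mathrm{Corr}(f,g)|,$$ the second supremum being over all real square-integrable $f,g$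 such that $f$ is $\mathcal A$-measurable and $g$ is $\mathcal B$-measurable, with $\mathrm{Corr}(f,g)=0$ if $f$ or $g$ is almost surely constant. For $S\subset\mathbb Z^d$ let $\sigma_S$ be the $\sigma$-field generated by $(X_k,\ k\in S)$. Then * $\alpha(n)=\sup\alpha(\sigma_S,\sigma_T)$ and $\rho(n)=\sup\rho(\sigma_S,\sigma_T)$, the suprema being over all pairs $S=\{k: k_u\le j\}$, $T=\{k: k_u\ge j+n\}$ with $j\in\mathbb Z$ and $u\in\{1,\dots,d\}$; * $\rho'(n)=\sup\rho(\sigma_S,\sigma_T)$ over all pairs $S=\{k:k_u\in G\}$, $T=\{k:k_u\in H\}$ with $u\in\{1,\dots,d\}$ and $G,H\subset\mathbb Z$ nonempty, disjoint, and $\min_{g\in G,\,h\in H}|g-h|\ge n$; * $\rho^*(n)=\sup\rho(\sigma_S,\sigma_T)$ over all pairs of nonempty disjoint $S,T\subset\mathbb Z^d$ with $\min_{s\in S,\,t\in T}\|s-t\|\ge n$, where $\|\cdot\|$ is the Euclidean norm. -/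

import Mathlib

open MeasureTheory ProbabilityTheory

noncomputable section

namespace RandomFieldMixing

/-- The Euclidean norm on the integer lattice of dimension `d`. -/
def latticeNorm {d : ℕ} (k : Fin d → ℤ) : ℝ :=
  Real.sqrt (∑ u, (k u : ℝ) ^ 2)

/-- The distance between two nonempty sets of lattice points: the least Euclidean distance between
a point of `S` and a point of `T`. -/
def latticeDist {d : ℕ} (S T : Set (Fin d → ℤ)) : ℝ :=
  sInf {r : ℝ | ∃ s ∈ S, ∃ t ∈ T, r = latticeNorm (s - t)}

/-- The distance between two nonempty sets of integers (the one-dimensional case). -/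
def intDist (G H : Set ℤ) : ℝ :=
  sInf {r : ℝ | ∃ g ∈ G, ∃ h ∈ H, r = |(g : ℝ) - (h : ℝ)|}

/-- The σ-field generated by the variables `X k`, `k ∈ S`. -/
abbrev sigmaField {ι Ω : Type*} (X : ι → Ω → ℝ) (S : Set ι) : MeasurableSpace Ω :=
  ⨆ k ∈ S, MeasurableSpace.comap (X k) inferInstance

/-- The correlation of two square-integrable random variables. If one of them is almost surely
constant, this is `0` (convention `0 / 0 = 0`). -/
def corr {Ω : Type*} [MeasurableSpace Ω] (P : Measure Ω) (f g : Ω → ℝ) : ℝ :=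
  cov[f, g; P] / (Real.sqrt Var[f; P] * Real.sqrt Var[g; P])

/-- The measure of dependence `α(𝒜, ℬ)` between two sub-σ-fields: the supremum of
`|P(A ∩ B) - P(A) P(B)|` over `A ∈ 𝒜`, `B ∈ ℬ`. -/
def alphaDep {Ω : Type*} (𝒜 ℬ : MeasurableSpace Ω) [MeasurableSpace Ω] (P : Measure Ω) : ℝ :=
  sSup {r : ℝ | ∃ A B : Set Ω, MeasurableSet[𝒜] A ∧ MeasurableSet[ℬ] B ∧
    r = |P.real (A ∩ B) - P.real A * P.real B|}

/-- The maximal correlation coefficient `ρ(𝒜, ℬ)` between two sub-σ-fields: the supremum of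
`|Corr(f, g)|` over square-integrable `𝒜`-measurable `f` and `ℬ`-measurable `g`. -/
def rhoDep {Ω : Type*} (𝒜 ℬ : MeasurableSpace Ω) [MeasurableSpace Ω] (P : Measure Ω) : ℝ :=
  sSup {r : ℝ | ∃ f g : Ω → ℝ, Measurable[𝒜] f ∧ Measurable[ℬ] g ∧
    MemLp f 2 P ∧ MemLp g 2 P ∧ r = |corr P f g|}

section Field

variable {Ω : Type*} [MeasurableSpace Ω] (P : Measure Ω) {d : ℕ} (X : (Fin d → ℤ) → Ω → ℝ)

/-- Strict stationarity: for every `v`, the shifted field `(X (k + v))` and the field `(X k)` have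
the same law on the product space. -/
def StrictlyStationary : Prop :=
  ∀ v : Fin d → ℤ, IdentDistrib (fun ω k => X (k + v) ω) (fun ω k => X k ω) P P

/-- `N`-tuplewise independence: any `N` variables of the field with distinct indices are
independent. -/
def TuplewiseIndependent (N : ℕ) : Prop :=
  ∀ k : Fin N → (Fin d → ℤ), Function.Injective k → iIndepFun (fun i => X (k i)) P

/-- The coefficient `α(n)`: the supremum is over pairs of half-spaces `{k | k u ≤ j}` and
`{k | j + n ≤ k u}`. -/
def alphaCoeff (n : ℕ) : ℝ :=
  sSup {r : ℝ | ∃ (j : ℤ) (u : Fin d),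
    r = alphaDep (sigmaField X {k | k u ≤ j}) (sigmaField X {k | j + n ≤ k u}) P}

/-- The coefficient `ρ(n)`: the supremum is over pairs of half-spaces `{k | k u ≤ j}` and
`{k | j + n ≤ k u}`. -/
def rhoCoeff (n : ℕ) : ℝ :=
  sSup {r : ℝ | ∃ (j : ℤ) (u : Fin d),
    r = rhoDep (sigmaField X {k | k u ≤ j}) (sigmaField X {k | j + n ≤ k u}) P}

/-- The coefficient `ρ'(n)`: the supremum is over pairs `{k | k u ∈ G}` and `{k | k u ∈ H}`, where
`G` and `H` are nonempty disjoint sets of integers at distance at least `n`. -/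
def rhoPrimeCoeff (n : ℕ) : ℝ :=
  sSup {r : ℝ | ∃ (u : Fin d) (G H : Set ℤ),
    G.Nonempty ∧ H.Nonempty ∧ Disjoint G H ∧ (n : ℝ) ≤ intDist G H ∧
    r = rhoDep (sigmaField X {k | k u ∈ G}) (sigmaField X {k | k u ∈ H}) P}

/-- The coefficient `ρ*(n)`: the supremum is over all pairs of nonempty disjoint sets of lattice
points at distance at least `n`. -/
def rhoStarCoeff (n : ℕ) : ℝ :=
  sSup {r : ℝ | ∃ S T : Set (Fin d → ℤ),
    S.Nonempty ∧ T.Nonempty ∧ Disjoint S T ∧ (n : ℝ) ≤ latticeDist S T ∧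
    r = rhoDep (sigmaField X S) (sigmaField X T) P}

end Field

end RandomFieldMixing

end

/-!
Split the bits of independent blocks among the sites of the lattice. Let `M = N + 1`. For each scale
`n` and each base point `l` of the lattice take a vector of `M` bits whose law has density
`1 + c (n + 1) * parity` with respect to the uniform law (`parityMeasure`), all these blocks being
independent, and let bit `i` of the block be shown at the site `l + (n + 1) * i * e₀`. The value of
the field at a site has as binary digits all the bits shown there (`bitField`).

* Stationarity holds because the law of a block does not depend on its base point.
* Any `M - 1` bits of a block are fair and independent, as a function that ignores one bit is
  orthogonal to the parity (`sum_mul_parity_eq_zero`). Since `N` sites show at most `N < M` bits of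
  any block, the bits they show are all fair and independent (`map_siteBits`). This gives the
  independence of `N`-tuples; and binary expansion turns independent fair bits into a uniform
  number, from which the bits can be read off almost surely (`map_ofDigits_fairBit`,
  `ae_digits_ofDigits`).
* For two disjoint sets of bits of one block the maximal correlation is at most the bias
  `c (n + 1)`, and it vanishes unless the two sets split the block completely
  (`maxCorrLE_bitMask`). The maximal correlation of a family of independent pairs is the largest one
  among the pairs (`maxCorrLE_pi`): for two pairs one conditions on the second (`MaxCorrLE.prod`),
  finitely many pairs are handled by induction, and infinitely many by approximation in `L²`. If two
  sets of sites are at distance at least `m`, a block split between them has two neighbouring bits on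
  different sides, so its step `n + 1` is at least `m` and its bias at most `c m`. Hence the maximal
  correlation is at most `c m` (`maxCorrLE_configMask`).
* Since the standard deviation of an indicator is at most `1 / 2`, always `4 α ≤ ρ`. In the block of
  step `m` the first bit and the parity of the other bits attain `α = c m / 4`
  (`parityMeasure_real_head_inter_tail`), and these are shown in half-spaces at distance `m`. So all
  four coefficients are equal to `c m`.
-/

noncomputable section

namespace RandomFieldMixing

/-! ### Covariance -/

section Covariance

variable {Ω : Type*} [MeasurableSpace Ω] {μ : Measure Ω}

lemma abs_covariance_le_sqrt_variance_mul [IsFiniteMeasure μ] {f g : Ω → ℝ} (hf : MemLp f 2 μ)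
    (hg : MemLp g 2 μ) : |cov[f, g; μ]| ≤ √Var[f; μ] * √Var[g; μ] := by
  have h : ∀ t : ℝ, 0 ≤ Var[g; μ] * (t * t) + 2 * cov[f, g; μ] * t + Var[f; μ] := fun t => by
    have := variance_nonneg (f + t • g) μ
    rw [variance_add hf (hg.const_smul t), covariance_smul_right, variance_smul] at this
    linarith
  have := discrim_le_zero h
  rw [discrim] at this
  rw [← Real.sqrt_mul (variance_nonneg _ _)]
  exact Real.abs_le_sqrt (by linarith)

lemma sqrt_variance_add_le [IsFiniteMeasure μ] {f g : Ω → ℝ} (hf : MemLp f 2 μ)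
    (hg : MemLp g 2 μ) : √Var[f + g; μ] ≤ √Var[f; μ] + √Var[g; μ] := by
  have h := (le_abs_self _).trans (abs_covariance_le_sqrt_variance_mul hf hg)
  rw [Real.sqrt_le_left (by positivity), variance_add hf hg, add_sq,
    Real.sq_sqrt (variance_nonneg _ _), Real.sq_sqrt (variance_nonneg _ _)]
  linarith

lemma sqrt_variance_le_eLpNorm [IsProbabilityMeasure μ] {f : Ω → ℝ} (hf : MemLp f 2 μ) :
    √Var[f; μ] ≤ (eLpNorm f 2 μ).toReal := by
  rw [Real.sqrt_le_left ENNReal.toReal_nonneg]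
  refine (variance_le_expectation_sq hf.aestronglyMeasurable).trans (le_of_eq ?_)
  have h := hf.eLpNorm_eq_integral_rpow_norm (by norm_num) (by norm_num)
  have h0 : (0 : ℝ) ≤ ∫ a, f a ^ 2 ∂μ := integral_nonneg fun _ => sq_nonneg _
  simp only [ENNReal.toReal_ofNat, Real.rpow_ofNat, Real.norm_eq_abs, sq_abs] at h
  rw [h, ENNReal.toReal_ofReal (Real.rpow_nonneg h0 _), ← Real.rpow_natCast,
    ← Real.rpow_mul h0]
  simp

lemma covariance_map_fun {Ω' : Type*} [MeasurableSpace Ω'] {W : Ω → Ω'} (hW : Measurable W)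
    {f g : Ω' → ℝ} (hf : Measurable f) (hg : Measurable g) :
    cov[f, g; μ.map W] = cov[f ∘ W, g ∘ W; μ] := by
  simp only [covariance, Function.comp_apply]
  rw [integral_map hW.aemeasurable (by fun_prop), integral_map hW.aemeasurable (by fun_prop),
    integral_map hW.aemeasurable (by fun_prop)]

/-- The law of total covariance on a product space, conditioning on the second coordinate. -/
lemma covariance_prod {Ω' : Type*} [MeasurableSpace Ω'] {ν : Measure Ω'} [IsProbabilityMeasure μ]
    [IsProbabilityMeasure ν] {f g : Ω × Ω' → ℝ} (hf : Measurable f) (hg : Measurable g)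
    (hf2 : MemLp f 2 (μ.prod ν)) (hg2 : MemLp g 2 (μ.prod ν)) :
    (∀ᵐ y ∂ν, MemLp (fun x => f (x, y)) 2 μ) ∧
    MemLp (fun y => ∫ x, f (x, y) ∂μ) 2 ν ∧
    Integrable (fun y => cov[fun x => f (x, y), fun x => g (x, y); μ]) ν ∧
    cov[f, g; μ.prod ν] = cov[fun y => ∫ x, f (x, y) ∂μ, fun y => ∫ x, g (x, y) ∂μ; ν] +
      ∫ y, cov[fun x => f (x, y), fun x => g (x, y); μ] ∂ν := by
  have sec : ∀ {f : Ω × Ω' → ℝ}, Measurable f → MemLp f 2 (μ.prod ν) →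
      ∀ᵐ y ∂ν, MemLp (fun x => f (x, y)) 2 μ := fun {f} hf hf2 => by
    filter_upwards [hf2.integrable_sq.prod_left_ae] with y hy
    have hm : Measurable fun x => f (x, y) := by fun_prop
    exact (memLp_two_iff_integrable_sq hm.aestronglyMeasurable).2 hy
  have avg : ∀ {f : Ω × Ω' → ℝ}, Measurable f → MemLp f 2 (μ.prod ν) →
      MemLp (fun y => ∫ x, f (x, y) ∂μ) 2 ν := fun {f} hf hf2 => by
    have hm : StronglyMeasurable fun y => ∫ x, f (x, y) ∂μ :=
      hf.stronglyMeasurable.integral_prod_left'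
    refine (memLp_two_iff_integrable_sq hm.aestronglyMeasurable).2 ?_
    refine hf2.integrable_sq.integral_prod_right.mono' (hm.pow 2).aestronglyMeasurable ?_
    filter_upwards [sec hf hf2] with y hy
    rw [Real.norm_of_nonneg (sq_nonneg _)]
    have := variance_nonneg (fun x => f (x, y)) μ
    rw [variance_eq_sub hy] at this
    simpa using this
  have hfg : Integrable (fun p => f p * g p) (μ.prod ν) := hf2.integrable_mul hg2
  have hcov : ∀ᵐ y ∂ν, cov[fun x => f (x, y), fun x => g (x, y); μ] =
      ∫ x, f (x, y) * g (x, y) ∂μ - (∫ x, f (x, y) ∂μ) * ∫ x, g (x, y) ∂μ := by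
    filter_upwards [sec hf hf2, sec hg hg2] with y h1 h2
    exact covariance_eq_sub h1 h2
  have hi1 : Integrable (fun y => ∫ x, f (x, y) * g (x, y) ∂μ) ν := hfg.integral_prod_right
  have hi2 : Integrable (fun y => (∫ x, f (x, y) ∂μ) * ∫ x, g (x, y) ∂μ) ν :=
    (avg hf hf2).integrable_mul (avg hg hg2)
  refine ⟨sec hf hf2, avg hf hf2, (hi1.sub hi2).congr (hcov.mono fun y hy => hy.symm), ?_⟩
  rw [integral_congr_ae hcov, integral_sub hi1 hi2, covariance_eq_sub hf2 hg2,
    covariance_eq_sub (avg hf hf2) (avg hg hg2),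
    integral_prod_symm _ (hf2.integrable one_le_two),
    integral_prod_symm _ (hg2.integrable one_le_two)]
  simp only [Pi.mul_apply]
  rw [integral_prod_symm _ hfg]
  ring

end Covariance

/-! ### Maximal correlation and its tensorization for two pairs -/

section MaxCorr

variable {Ω α β : Type*} [MeasurableSpace Ω] [MeasurableSpace α] [MeasurableSpace β]

/-- The maximal correlation of the random elements `U` and `V` is at most `c`: the covariance of
any square-integrable `F ∘ U` and `G ∘ V` is at most `c` times the product of their standard
deviations. Stating it through `F` and `G`, rather than through functions measurable for the
σ-fields of `U` and `V`, makes it depend on the joint law of `(U, V)` only. -/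
def MaxCorrLE (μ : Measure Ω) (U : Ω → α) (V : Ω → β) (c : ℝ) : Prop :=
  ∀ (F : α → ℝ) (G : β → ℝ), Measurable F → Measurable G → MemLp (F ∘ U) 2 μ →
    MemLp (G ∘ V) 2 μ → |cov[F ∘ U, G ∘ V; μ]| ≤ c * (√Var[F ∘ U; μ] * √Var[G ∘ V; μ])

variable {μ : Measure Ω} {U : Ω → α} {V : Ω → β} {c : ℝ}

lemma MaxCorrLE.comp {α' β' : Type*} [MeasurableSpace α'] [MeasurableSpace β']
    (h : MaxCorrLE μ U V c) {φ : α → α'} {ψ : β → β'} (hφ : Measurable φ) (hψ : Measurable ψ) :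
    MaxCorrLE μ (φ ∘ U) (ψ ∘ V) c :=
  fun F G hF hG => h (F ∘ φ) (G ∘ ψ) (hF.comp hφ) (hG.comp hψ)

/-- The bound only depends on the law of `(U, V)`, so it can be transported along maps. -/
lemma maxCorrLE_map_iff {Ω' : Type*} [MeasurableSpace Ω'] {W : Ω' → Ω} {ν : Measure Ω'}
    (hW : Measurable W) (hU : Measurable U) (hV : Measurable V) :
    MaxCorrLE (ν.map W) U V c ↔ MaxCorrLE ν (U ∘ W) (V ∘ W) c := by
  refine forall₄_congr fun F G hF hG => ?_
  rw [memLp_map_measure_iff (hF.comp hU).aestronglyMeasurable hW.aemeasurable,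
    memLp_map_measure_iff (hG.comp hV).aestronglyMeasurable hW.aemeasurable,
    covariance_map_fun hW (hF.comp hU) (hG.comp hV), variance_map (by fun_prop) (by fun_prop),
    variance_map (by fun_prop) (by fun_prop)]
  rfl

/-- Tensorization of maximal correlation on a product space: condition on the second coordinate,
apply the first bound to the sections and the second bound to the averages, and add up with the
Cauchy-Schwarz inequality. -/
lemma MaxCorrLE.prod {Ω' α' β' : Type*} [MeasurableSpace Ω'] [MeasurableSpace α']
    [MeasurableSpace β'] {ν : Measure Ω'} [IsProbabilityMeasure μ] [IsProbabilityMeasure ν]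
    {U' : Ω' → α'} {V' : Ω' → β'} (hU : Measurable U) (hV : Measurable V) (hU' : Measurable U')
    (hV' : Measurable V') (hc : 0 ≤ c) (h : MaxCorrLE μ U V c) (h' : MaxCorrLE ν U' V' c) :
    MaxCorrLE (μ.prod ν) (Prod.map U U') (Prod.map V V') c := by
  intro F G hF hG hF2 hG2
  have hf : Measurable (F ∘ Prod.map U U') := by fun_prop
  have hg : Measurable (G ∘ Prod.map V V') := by fun_prop
  obtain ⟨fs, fa, -, -⟩ := covariance_prod hf hg hF2 hG2
  obtain ⟨gs, ga, -, -⟩ := covariance_prod hg hf hG2 hF2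
  obtain ⟨-, -, ii, e⟩ := covariance_prod hf hg hF2 hG2
  obtain ⟨-, -, fi, ef⟩ := covariance_prod hf hf hF2 hF2
  obtain ⟨-, -, gi, eg⟩ := covariance_prod hg hg hG2 hG2
  rw [covariance_self hf.aemeasurable, covariance_self fa.aemeasurable] at ef
  rw [covariance_self hg.aemeasurable, covariance_self ga.aemeasurable] at eg
  have vf : ∀ y, cov[fun x => (F ∘ Prod.map U U') (x, y), fun x => (F ∘ Prod.map U U') (x, y); μ]
      = Var[fun x => (F ∘ Prod.map U U') (x, y); μ] := fun y => covariance_self (by fun_prop)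
  have vg : ∀ y, cov[fun x => (G ∘ Prod.map V V') (x, y), fun x => (G ∘ Prod.map V V') (x, y); μ]
      = Var[fun x => (G ∘ Prod.map V V') (x, y); μ] := fun y => covariance_self (by fun_prop)
  simp only [vf] at ef fi
  simp only [vg] at eg gi
  set f := F ∘ Prod.map U U'
  set g := G ∘ Prod.map V V'
  -- the averages are functions of the second coordinates
  have h1 : |cov[fun y => ∫ x, f (x, y) ∂μ, fun y => ∫ x, g (x, y) ∂μ; ν]| ≤
      c * (√Var[fun y => ∫ x, f (x, y) ∂μ; ν] * √Var[fun y => ∫ x, g (x, y) ∂μ; ν]) := by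
    refine h' (fun a => ∫ x, F (U x, a) ∂μ) (fun b => ∫ x, G (V x, b) ∂μ) ?_ ?_ fa ga
    · have : Measurable fun p : Ω × α' => F (U p.1, p.2) := by fun_prop
      exact this.stronglyMeasurable.integral_prod_left'.measurable
    · have : Measurable fun p : Ω × β' => G (V p.1, p.2) := by fun_prop
      exact this.stronglyMeasurable.integral_prod_left'.measurable
  have hsf : MemLp (fun y => √Var[fun x => f (x, y); μ]) 2 ν := by
    refine (memLp_two_iff_integrable_sq ?_).2 ?_
    · exact fi.aestronglyMeasurable.aemeasurable.sqrt.aestronglyMeasurable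
    · exact fi.congr (.of_forall fun y => (Real.sq_sqrt (variance_nonneg _ _)).symm)
  have hsg : MemLp (fun y => √Var[fun x => g (x, y); μ]) 2 ν := by
    refine (memLp_two_iff_integrable_sq ?_).2 ?_
    · exact gi.aestronglyMeasurable.aemeasurable.sqrt.aestronglyMeasurable
    · exact gi.congr (.of_forall fun y => (Real.sq_sqrt (variance_nonneg _ _)).symm)
  have h2 : |∫ y, cov[fun x => f (x, y), fun x => g (x, y); μ] ∂ν| ≤
      c * ∫ y, √Var[fun x => f (x, y); μ] * √Var[fun x => g (x, y); μ] ∂ν := by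
    rw [← integral_const_mul]
    refine (abs_integral_le_integral_abs).trans (integral_mono_ae ii.abs
      ((hsf.integrable_mul hsg).const_mul c) ?_)
    filter_upwards [fs, gs] with y hy1 hy2
    exact h (fun a => F (a, U' y)) (fun b => G (b, V' y)) (by fun_prop) (by fun_prop) hy1 hy2
  have h3 : ∫ y, √Var[fun x => f (x, y); μ] * √Var[fun x => g (x, y); μ] ∂ν ≤
      √(∫ y, Var[fun x => f (x, y); μ] ∂ν) * √(∫ y, Var[fun x => g (x, y); μ] ∂ν) := by
    have := integral_mul_le_Lp_mul_Lq_of_nonneg (μ := ν) Real.HolderConjugate.two_two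
      (f := fun y => √Var[fun x => f (x, y); μ]) (g := fun y => √Var[fun x => g (x, y); μ])
      (.of_forall fun y => Real.sqrt_nonneg _) (.of_forall fun y => Real.sqrt_nonneg _)
      (by simpa using hsf) (by simpa using hsg)
    simpa only [Real.rpow_ofNat, Real.sq_sqrt (variance_nonneg _ _), ← Real.sqrt_eq_rpow] using this
  rw [e, ef, eg]
  have a0 := variance_nonneg (fun y => ∫ x, f (x, y) ∂μ) ν
  have b0 := variance_nonneg (fun y => ∫ x, g (x, y) ∂μ) ν
  have a'0 : 0 ≤ ∫ y, Var[fun x => f (x, y); μ] ∂ν := integral_nonneg fun _ => variance_nonneg _ _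
  have b'0 : 0 ≤ ∫ y, Var[fun x => g (x, y); μ] ∂ν := integral_nonneg fun _ => variance_nonneg _ _
  calc _ ≤ _ := abs_add_le _ _
    _ ≤ c * (√Var[fun y => ∫ x, f (x, y) ∂μ; ν] * √Var[fun y => ∫ x, g (x, y) ∂μ; ν]) +
        c * (√(∫ y, Var[fun x => f (x, y); μ] ∂ν) * √(∫ y, Var[fun x => g (x, y); μ] ∂ν)) := by
      gcongr
      exact h2.trans (by gcongr)
    _ = c * (√Var[fun y => ∫ x, f (x, y) ∂μ; ν] * √Var[fun y => ∫ x, g (x, y) ∂μ; ν] +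
        √(∫ y, Var[fun x => f (x, y); μ] ∂ν) * √(∫ y, Var[fun x => g (x, y); μ] ∂ν)) := by ring
    _ ≤ _ := by
      gcongr
      rw [← Real.sqrt_mul (add_nonneg a0 a'0)]
      refine Real.le_sqrt_of_sq_le ?_
      generalize ∫ y, Var[fun x => f (x, y); μ] ∂ν = a' at *
      generalize ∫ y, Var[fun x => g (x, y); μ] ∂ν = b' at *
      generalize Var[fun y => ∫ x, f (x, y) ∂μ; ν] = a at *
      generalize Var[fun y => ∫ x, g (x, y) ∂μ; ν] = b at *
      have e1 := Real.sq_sqrt a0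
      have e2 := Real.sq_sqrt b0
      have e3 := Real.sq_sqrt a'0
      have e4 := Real.sq_sqrt b'0
      nlinarith [sq_nonneg (√a * √b' - √a' * √b)]

/-- Tensorization of maximal correlation for two independent pairs. -/
lemma MaxCorrLE.prodMk {α' β' : Type*} [MeasurableSpace α'] [MeasurableSpace β']
    [IsProbabilityMeasure μ] {U' : Ω → α'} {V' : Ω → β'} (hU : Measurable U) (hV : Measurable V)
    (hU' : Measurable U') (hV' : Measurable V') (hc : 0 ≤ c) (h : MaxCorrLE μ U V c)
    (h' : MaxCorrLE μ U' V' c) (hind : IndepFun (fun ω => (U ω, V ω)) (fun ω => (U' ω, V' ω)) μ) :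
    MaxCorrLE μ (fun ω => (U ω, U' ω)) (fun ω => (V ω, V' ω)) c := by
  have hW : Measurable fun ω => (U ω, V ω) := by fun_prop
  have hW' : Measurable fun ω => (U' ω, V' ω) := by fun_prop
  have := Measure.isProbabilityMeasure_map (μ := μ) hW.aemeasurable
  have := Measure.isProbabilityMeasure_map (μ := μ) hW'.aemeasurable
  have key := MaxCorrLE.prod measurable_fst measurable_snd measurable_fst measurable_snd hc
    ((maxCorrLE_map_iff hW measurable_fst measurable_snd).2 h)
    ((maxCorrLE_map_iff hW' measurable_fst measurable_snd).2 h')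
  rw [← (indepFun_iff_map_prod_eq_prod_map_map hW.aemeasurable hW'.aemeasurable).1 hind,
    maxCorrLE_map_iff (hW.prodMk hW') (by fun_prop) (by fun_prop)] at key
  exact key

end MaxCorr

/-! ### Tensorization of maximal correlation for infinitely many pairs -/

section Density

open scoped ENNReal

/-- Square-integrable functions of finitely many coordinates are dense in `L²` of a product
space. -/
lemma exists_restrict_eLpNorm_sub_le {ι : Type*} {E : ι → Type*} [∀ i, MeasurableSpace (E i)]
    {ν : Measure (∀ i, E i)} [IsFiniteMeasure ν] {f : (∀ i, E i) → ℝ} (hf : MemLp f 2 ν)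
    {ε : ℝ≥0∞} (hε : ε ≠ 0) :
    ∃ (s : Finset ι) (g : (∀ i : s, E i) → ℝ), Measurable g ∧ MemLp (g ∘ s.restrict) 2 ν ∧
      eLpNorm (f - g ∘ s.restrict) 2 ν ≤ ε := by
  classical
  have dense := Measure.MeasureDense.of_generateFrom_isSetAlgebra_finite (μ := ν)
    (isSetAlgebra_measurableCylinders (α := E)) generateFrom_measurableCylinders.symm
  suffices key : ∃ h : (∀ i, E i) → ℝ, eLpNorm (f - h) 2 ν ≤ ε ∧
      ∃ (s : Finset ι) (g : (∀ i : s, E i) → ℝ), Measurable g ∧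
        MemLp (g ∘ s.restrict) 2 ν ∧ h = g ∘ s.restrict by
    obtain ⟨_, hle, s, g, hg, hg2, rfl⟩ := key
    exact ⟨s, g, hg, hg2, hle⟩
  refine hf.induction_dense (by norm_num) _ ?_ ?_ ?_ hε
  · intro c t ht _ ε hε
    obtain ⟨η, hη, hη'⟩ := exists_eLpNorm_indicator_le (μ := ν) (p := 2) (by norm_num) c hε
    obtain ⟨t', ht', hd⟩ := dense.approx t ht (measure_ne_top _ _) η (by exact_mod_cast hη)
    obtain ⟨s, S, hS, rfl⟩ := (mem_measurableCylinders t').1 ht'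
    have heq : (S.indicator fun _ => c) ∘ s.restrict = (cylinder s S).indicator fun _ => c := by
      ext x
      rfl
    refine ⟨(S.indicator fun _ => c) ∘ s.restrict, ?_, s, S.indicator fun _ => c,
      measurable_const.indicator hS, ?_, rfl⟩
    · rw [heq]
      refine le_trans (le_of_eq ?_) (hη' (symmDiff t (cylinder s S)) (hd.le.trans (by simp)))
      rw [symmDiff_comm]
      exact (eLpNorm_congr_norm_ae (.of_forall fun x =>
        (Set.apply_indicator_symmDiff norm_neg _ _ _ x).symm))
    · rw [heq]
      exact (memLp_const c).indicator hS.cylinder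
  · rintro _ _ ⟨s, g, hg, hg2, rfl⟩ ⟨s', g', hg', hg2', rfl⟩
    refine ⟨s ∪ s', fun x => g (Finset.restrict₂ (Finset.subset_union_left) x) +
      g' (Finset.restrict₂ (Finset.subset_union_right) x), ?_, hg2.add hg2', rfl⟩
    exact (hg.comp (Finset.measurable_restrict₂ _)).add (hg'.comp (Finset.measurable_restrict₂ _))
  · rintro _ ⟨s, g, hg, hg2, rfl⟩
    exact hg2.aestronglyMeasurable

end Density

section Tensorization

variable {Ω α β : Type*} [MeasurableSpace Ω] [MeasurableSpace α] [MeasurableSpace β]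
  {μ : Measure Ω} [IsProbabilityMeasure μ] {c : ℝ} {ι : Type*}

/-- The covariance bound passes to limits in `L²`. -/
lemma abs_covariance_le_of_forall_approx {f g : Ω → ℝ} (hc : 0 ≤ c) (hf : MemLp f 2 μ)
    (hg : MemLp g 2 μ) (h : ∀ ε : ℝ, 0 < ε → ∃ f' g' : Ω → ℝ, MemLp f' 2 μ ∧ MemLp g' 2 μ ∧
      √Var[f - f'; μ] ≤ ε ∧ √Var[g - g'; μ] ≤ ε ∧
      |cov[f', g'; μ]| ≤ c * (√Var[f'; μ] * √Var[g'; μ])) :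
    |cov[f, g; μ]| ≤ c * (√Var[f; μ] * √Var[g; μ]) := by
  set a := √Var[f; μ]
  set b := √Var[g; μ]
  have hlim : Filter.Tendsto (fun ε : ℝ => ε * b + (a + ε) * ε + c * ((a + ε) * (b + ε)))
      (nhdsWithin 0 (Set.Ioi 0)) (nhds (0 * b + (a + 0) * 0 + c * ((a + 0) * (b + 0)))) :=
    (Continuous.tendsto (by fun_prop) 0).mono_left nhdsWithin_le_nhds
  simp only [zero_mul, mul_zero, add_zero, zero_add] at hlim
  refine ge_of_tendsto hlim ?_
  filter_upwards [self_mem_nhdsWithin] with ε hε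
  obtain ⟨f', g', hf', hg', h1, h2, h3⟩ := h ε hε
  have hfa : √Var[f'; μ] ≤ a + ε := by
    have := sqrt_variance_add_le (hf.sub hf').neg hf
    rw [variance_neg, neg_sub, sub_add_cancel] at this
    linarith
  have hgb : √Var[g'; μ] ≤ b + ε := by
    have := sqrt_variance_add_le (hg.sub hg').neg hg
    rw [variance_neg, neg_sub, sub_add_cancel] at this
    linarith
  have e : cov[f, g; μ] = cov[f - f', g; μ] + (cov[f', g - g'; μ] + cov[f', g'; μ]) := by
    rw [covariance_sub_left hf hf' hg, covariance_sub_right hf' hg hg']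
    ring
  have i1 := abs_covariance_le_sqrt_variance_mul (hf.sub hf') hg
  have i2 := abs_covariance_le_sqrt_variance_mul hf' (hg.sub hg')
  have ε0 : 0 ≤ ε := le_of_lt hε
  calc |cov[f, g; μ]| ≤ |cov[f - f', g; μ]| + (|cov[f', g - g'; μ]| + |cov[f', g'; μ]|) := by
        rw [e]
        exact (abs_add_le _ _).trans (add_le_add le_rfl (abs_add_le _ _))
    _ ≤ ε * b + ((a + ε) * ε + c * ((a + ε) * (b + ε))) := by
      refine add_le_add (i1.trans ?_) (add_le_add (i2.trans ?_) (h3.trans ?_)) <;> gcongr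
    _ = _ := by ring

lemma exists_finset_sqrt_variance_sub_le {W : ι → Ω → α} (hW : ∀ i, Measurable (W i))
    {F : (ι → α) → ℝ} (hF : Measurable F) (hF2 : MemLp (F ∘ fun ω i => W i ω) 2 μ) {ε : ℝ}
    (hε : 0 < ε) :
    ∃ (s : Finset ι) (g : (s → α) → ℝ), Measurable g ∧ MemLp (g ∘ fun ω (i : s) => W i ω) 2 μ ∧
      √Var[(F ∘ fun ω i => W i ω) - g ∘ fun ω (i : s) => W i ω; μ] ≤ ε := by
  have hm : Measurable fun ω i => W i ω := by fun_prop
  obtain ⟨s, g, hg, hg2, hle⟩ := exists_restrict_eLpNorm_sub_le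
    ((memLp_map_measure_iff hF.aestronglyMeasurable hm.aemeasurable).2 hF2)
    (ε := ENNReal.ofReal ε) (by simpa using hε)
  have hgs : Measurable (g ∘ s.restrict (π := fun _ => α)) :=
    hg.comp (measurable_pi_lambda _ fun i => measurable_pi_apply _)
  have hg2' := (memLp_map_measure_iff hgs.aestronglyMeasurable hm.aemeasurable).1 hg2
  refine ⟨s, g, hg, hg2', ?_⟩
  rw [eLpNorm_map_measure (hF.sub hgs).aestronglyMeasurable hm.aemeasurable] at hle
  refine (sqrt_variance_le_eLpNorm (hF2.sub hg2')).trans ?_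
  exact ENNReal.toReal_le_of_le_ofReal hε.le hle

/-- The restriction to `insert a s` is a measurable function of the value at `a` and the
restriction to `s`. -/
lemma exists_measurable_restrict_insert [DecidableEq ι] (a : ι) (s : Finset ι) :
    ∃ φ : α × (s → α) → ↥(insert a s) → α, Measurable φ ∧
      ∀ x : ι → α, φ (x a, fun i => x i) = fun i : ↥(insert a s) => x i := by
  refine ⟨fun p i => if hi : i.1 ∈ s then p.2 ⟨i, hi⟩ else p.1, ?_, fun x => ?_⟩
  · refine measurable_pi_lambda _ fun i => ?_
    by_cases hi : i.1 ∈ s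
    · simp only [hi, dite_true]
      fun_prop
    · simp only [hi, dite_false]
      fun_prop
  · ext i
    by_cases hi : i.1 ∈ s
    · simp [hi]
    · simp [(Finset.mem_insert.1 i.2).resolve_right hi]

lemma maxCorrLE_finset_restrict {U : ι → Ω → α} {V : ι → Ω → β} (hU : ∀ i, Measurable (U i))
    (hV : ∀ i, Measurable (V i)) (hc : 0 ≤ c) (h : ∀ i, MaxCorrLE μ (U i) (V i) c)
    (hind : iIndepFun (fun i ω => (U i ω, V i ω)) μ) (s : Finset ι) :
    MaxCorrLE μ (fun ω (i : s) => U i ω) (fun ω (i : s) => V i ω) c := by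
  classical
  induction s using Finset.induction_on with
  | empty =>
    intro F G hF hG hF2 hG2
    have : F ∘ (fun ω (i : (∅ : Finset ι)) => U i ω) = 
        fun _ => F fun i => absurd i.2 (Finset.notMem_empty _) := by
      ext ω
      exact congrArg F (Subsingleton.elim _ _)
    rw [this, covariance_const_left, abs_zero]
    positivity
  | insert a s ha ih =>
    have hpair : MaxCorrLE μ (fun ω => (U a ω, fun i : s => U i ω))
        (fun ω => (V a ω, fun i : s => V i ω)) c := by
      refine MaxCorrLE.prodMk (hU a) (hV a) (by fun_prop) (by fun_prop) hc (h a) ih ?_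
      have := hind.indepFun_finset {a} s (by simpa using ha)
        (fun i => (hU i).prodMk (hV i))
      have m1 : Measurable fun x : ({a} : Finset ι) → α × β => x ⟨a, by simp⟩ := by fun_prop
      have m2 : Measurable fun x : s → α × β => (fun i => (x i).1, fun i => (x i).2) := by fun_prop
      exact this.comp m1 m2
    obtain ⟨φ, hφ, hφ'⟩ := exists_measurable_restrict_insert (α := α) a s
    obtain ⟨ψ, hψ, hψ'⟩ := exists_measurable_restrict_insert (α := β) a s
    have := hpair.comp hφ hψ
    simpa only [Function.comp_def, fun ω => hφ' (U · ω), fun ω => hψ' (V · ω)]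
      using this

/-- Tensorization of maximal correlation: for independent pairs `(U i, V i)`, each of maximal
correlation at most `c`, so is the pair formed by all the `U i` and all the `V i`. -/
theorem maxCorrLE_pi {U : ι → Ω → α} {V : ι → Ω → β} (hU : ∀ i, Measurable (U i))
    (hV : ∀ i, Measurable (V i)) (hc : 0 ≤ c) (h : ∀ i, MaxCorrLE μ (U i) (V i) c)
    (hind : iIndepFun (fun i ω => (U i ω, V i ω)) μ) :
    MaxCorrLE μ (fun ω i => U i ω) (fun ω i => V i ω) c := by
  classical
  intro F G hF hG hF2 hG2
  refine abs_covariance_le_of_forall_approx hc hF2 hG2 fun ε hε => ?_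
  obtain ⟨s, f, hf, hf2, hfε⟩ := exists_finset_sqrt_variance_sub_le hU hF hF2 hε
  obtain ⟨t, g, hg, hg2, hgε⟩ := exists_finset_sqrt_variance_sub_le hV hG hG2 hε
  refine ⟨_, _, hf2, hg2, hfε, hgε, ?_⟩
  have hs : Measurable (Finset.restrict₂ (π := fun _ => α) (s.subset_union_left (s₂ := t))) :=
    measurable_pi_lambda _ fun i => measurable_pi_apply _
  have ht : Measurable (Finset.restrict₂ (π := fun _ => β) (s.subset_union_right (s₂ := t))) :=
    measurable_pi_lambda _ fun i => measurable_pi_apply _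
  exact (maxCorrLE_finset_restrict hU hV hc h hind (s ∪ t)).comp hs ht f g hf hg hf2 hg2

end Tensorization

/-! ### Bit vectors with biased parity -/

section Block

open scoped ENNReal

variable {M : ℕ} {c : unitInterval}

/-- The parity character of a bit vector: `1` if it has an even number of ones, else `-1`. -/
def parity (x : Fin M → Fin 2) : ℝ := ∏ i, (-1) ^ (x i : ℕ)

/-- The weight of a bit vector under the law with parity bias `c`. -/
def parityWeight (c : unitInterval) (x : Fin M → Fin 2) : ℝ := (1 + c * parity x) / 2 ^ M

/-- The law on bit vectors of length `M` whose density with respect to the uniform law is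
`1 + c * parity`. Any `M - 1` of the bits are fair and independent. -/
def parityMeasure (M : ℕ) (c : unitInterval) : Measure (Fin M → Fin 2) :=
  ∑ x, ENNReal.ofReal (parityWeight c x) • Measure.dirac x

/-- The bit vector `x` with all bits outside `A` replaced by `0`. -/
def bitMask (A : Set (Fin M)) (x : Fin M → Fin 2) : Fin M → Fin 2 :=
  open scoped Classical in fun i => if i ∈ A then x i else 0

lemma parity_eq_one_or (x : Fin M → Fin 2) : parity x = 1 ∨ parity x = -1 := by
  unfold parity
  refine Finset.prod_induction _ (fun r => r = 1 ∨ r = -1) ?_ (Or.inl rfl) fun i _ =>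
    neg_one_pow_eq_or ℝ _
  rintro _ _ (rfl | rfl) (rfl | rfl) <;> norm_num

lemma abs_parity (x : Fin M → Fin 2) : |parity x| = 1 := by
  rcases parity_eq_one_or x with h | h <;> simp [h]

lemma parityWeight_nonneg (x : Fin M → Fin 2) : 0 ≤ parityWeight c x := by
  have := c.2.1
  have := c.2.2
  unfold parityWeight
  rcases parity_eq_one_or x with h | h <;> rw [h] <;> refine div_nonneg ?_ (by positivity) <;>
    linarith

/-- The bit vector `x` with bit `i` flipped. -/
def flipBit (i : Fin M) (x : Fin M → Fin 2) : Fin M → Fin 2 := Function.update x i (1 - x i)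

lemma flipBit_flipBit (i : Fin M) (x : Fin M → Fin 2) : flipBit i (flipBit i x) = x := by
  simp [flipBit]

lemma parity_flipBit (i : Fin M) (x : Fin M → Fin 2) : parity (flipBit i x) = -parity x := by
  unfold parity flipBit
  rw [← Finset.mul_prod_erase _ _ (Finset.mem_univ i),
    ← Finset.mul_prod_erase _ (fun j => (-1 : ℝ) ^ (x j : ℕ)) (Finset.mem_univ i),
    ← neg_mul]
  congr 1
  · generalize x i = a
    fin_cases a <;> simp
  · refine Finset.prod_congr rfl fun j hj => ?_
    rw [Function.update_of_ne (Finset.ne_of_mem_erase hj)]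

/-- A function not depending on some bit is uncorrelated with the parity. -/
lemma sum_mul_parity_eq_zero (i : Fin M) {h : (Fin M → Fin 2) → ℝ}
    (hh : ∀ x, h (flipBit i x) = h x) : ∑ x, h x * parity x = 0 := by
  have := Equiv.sum_comp (Function.Involutive.toPerm (flipBit i) (flipBit_flipBit i))
    fun x => h x * parity x
  simp only [Function.Involutive.toPerm, Equiv.coe_fn_mk, hh, parity_flipBit, mul_neg,
    Finset.sum_neg_distrib] at this
  linarith

lemma bitMask_flipBit {A : Set (Fin M)} {i : Fin M} (hi : i ∉ A) (x : Fin M → Fin 2) :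
    bitMask A (flipBit i x) = bitMask A x := by
  ext j
  by_cases hj : j ∈ A
  · have : j ≠ i := fun h => hi (h ▸ hj)
    simp [bitMask, flipBit, hj, this]
  · simp [bitMask, hj]

lemma integral_parityMeasure (f : (Fin M → Fin 2) → ℝ) :
    ∫ x, f x ∂parityMeasure M c = ∑ x, parityWeight c x * f x := by
  unfold parityMeasure
  rw [integral_finsetSum_measure fun _ _ => Integrable.of_finite.smul_measure ENNReal.ofReal_ne_top]
  simp [ENNReal.toReal_ofReal, parityWeight_nonneg]

/-- The bias changes an expectation by the uniform average of the product with the parity. -/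
lemma integral_parityMeasure_eq_add (f : (Fin M → Fin 2) → ℝ) :
    ∫ x, f x ∂parityMeasure M c =
      ∫ x, f x ∂parityMeasure M 0 + c * ((∑ x, f x * parity x) / 2 ^ M) := by
  rw [integral_parityMeasure, integral_parityMeasure, Finset.sum_div, Finset.mul_sum,
    ← Finset.sum_add_distrib]
  refine Finset.sum_congr rfl fun x _ => ?_
  simp only [parityWeight, Set.Icc.coe_zero]
  ring

lemma sum_parity [NeZero M] : ∑ x : Fin M → Fin 2, parity x = 0 := by
  simpa using sum_mul_parity_eq_zero (M := M) (h := fun _ => 1) 0 fun _ => rfl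

instance [NeZero M] : IsProbabilityMeasure (parityMeasure M c) := by
  have h : ∫ x, (1 : ℝ) ∂parityMeasure M c = 1 := by
    rw [integral_parityMeasure_eq_add, integral_parityMeasure]
    simp [sum_parity, parityWeight]
  constructor
  have hfin : parityMeasure M c Set.univ ≠ ∞ := by simp [parityMeasure]
  simpa [Measure.real, ENNReal.toReal_eq_one_iff] using h

lemma parityMeasure_real_apply [NeZero M] (s : Set (Fin M → Fin 2)) :
    (parityMeasure M c).real s = ∑ x, parityWeight c x * s.indicator 1 x := by
  rw [← integral_parityMeasure, integral_indicator_one (Set.toFinite s).measurableSet]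

/-- The parity bias is not seen by a proper subset of the bits. -/
lemma parityMeasure_map_bitMask [NeZero M] {A : Set (Fin M)} (hA : A ≠ Set.univ) :
    (parityMeasure M c).map (bitMask A) = (parityMeasure M 0).map (bitMask A) := by
  obtain ⟨i, hi⟩ := (Set.ne_univ_iff_exists_notMem A).1 hA
  have hm : Measurable (bitMask A) := measurable_of_finite _
  ext s hs
  rw [Measure.map_apply hm hs, Measure.map_apply hm hs, ← measureReal_eq_measureReal_iff,
    ← integral_indicator_one (hm hs), ← integral_indicator_one (hm hs),
    integral_parityMeasure_eq_add,
    sum_mul_parity_eq_zero i]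
  · simp
  · intro x
    exact congrArg (s.indicator (1 : (Fin M → Fin 2) → ℝ)) (bitMask_flipBit hi x)

/-- The law of a fair bit. -/
abbrev fairBit : Measure (Fin 2) := uniformOn Set.univ

instance : IsProbabilityMeasure fairBit :=
  isProbabilityMeasure_uniformOn Set.finite_univ Set.univ_nonempty

lemma parityMeasure_zero [NeZero M] :
    parityMeasure M 0 = Measure.infinitePi fun _ : Fin M => fairBit := by
  rw [Measure.infinitePi_eq_pi]
  refine Measure.ext_of_singleton fun x => ?_
  rw [Measure.pi_singleton, ← ENNReal.toReal_eq_toReal_iff' (measure_ne_top _ _)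
    (ENNReal.prod_ne_top fun i _ => measure_ne_top _ _)]
  change (parityMeasure M 0).real {x} = _
  rw [parityMeasure_real_apply, Finset.sum_eq_single x]
  · simp [parityWeight, uniformOn_univ]
  · intro y _ hy
    simp [hy]
  · simp

/-- Under the uniform law, functions of disjoint sets of bits are uncorrelated. -/
lemma covariance_parityMeasure_zero [NeZero M] {A B : Set (Fin M)} (hAB : Disjoint A B)
    (F G : (Fin M → Fin 2) → ℝ) :
    cov[F ∘ bitMask A, G ∘ bitMask B; parityMeasure M 0] = 0 := by
  classical
  have hbits : iIndepFun (fun (i : Fin M) (x : Fin M → Fin 2) => x i) (parityMeasure M 0) := by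
    rw [parityMeasure_zero]
    exact iIndepFun_infinitePi (X := fun _ a => a) fun _ => measurable_id
  have hdis : Disjoint A.toFinset B.toFinset := by simpa using hAB
  have h := hbits.indepFun_finset A.toFinset B.toFinset hdis fun i => by fun_prop
  have factor : ∀ A : Set (Fin M), bitMask A =
      (fun (y : A.toFinset → Fin 2) i => if hi : i ∈ A.toFinset then y ⟨i, hi⟩ else 0) ∘
        fun x i => x i := fun A => by
    ext x i
    simp [bitMask]
  rw [factor A, factor B, ← Function.comp_assoc, ← Function.comp_assoc]
  exact (h.comp (measurable_of_finite _) (measurable_of_finite _)).covariance_eq_zero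
    MemLp.of_discrete MemLp.of_discrete

/-- Functions of disjoint sets of bits have correlation at most `c`: after centering, the
covariance is `c` times the uniform average of their product with the parity. -/
lemma abs_covariance_parityMeasure_le [NeZero M] {A B : Set (Fin M)} (hAB : Disjoint A B)
    (hA : A ≠ Set.univ) (hB : B ≠ Set.univ) (F G : (Fin M → Fin 2) → ℝ) :
    (A ∪ B ≠ Set.univ → cov[F ∘ bitMask A, G ∘ bitMask B; parityMeasure M c] = 0) ∧
    |cov[F ∘ bitMask A, G ∘ bitMask B; parityMeasure M c]| ≤
      c * (√Var[F ∘ bitMask A; parityMeasure M c] * √Var[G ∘ bitMask B; parityMeasure M c]) := by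
  have hmean : ∀ {A : Set (Fin M)}, A ≠ Set.univ → ∀ F : (Fin M → Fin 2) → ℝ,
      ∫ x, F (bitMask A x) ∂parityMeasure M c = ∫ x, F (bitMask A x) ∂parityMeasure M 0 := by
    intro A hA F
    have hm : Measurable (bitMask A) := measurable_of_finite _
    rw [← integral_map hm.aemeasurable AEStronglyMeasurable.of_discrete,
      ← integral_map hm.aemeasurable AEStronglyMeasurable.of_discrete,
      parityMeasure_map_bitMask hA]
  have hvar : ∀ {A : Set (Fin M)}, A ≠ Set.univ → ∀ F : (Fin M → Fin 2) → ℝ,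
      Var[F ∘ bitMask A; parityMeasure M c] = Var[F ∘ bitMask A; parityMeasure M 0] := by
    intro A hA F
    rw [← variance_map (measurable_of_finite _).aemeasurable (measurable_of_finite _).aemeasurable,
      ← variance_map (measurable_of_finite _).aemeasurable (measurable_of_finite _).aemeasurable,
      parityMeasure_map_bitMask hA]
  -- `f` and `g` are centered under the law with bias `c` as well as under the uniform law
  set f : (Fin M → Fin 2) → ℝ := fun x => F (bitMask A x) - ∫ x, F (bitMask A x) ∂parityMeasure M 0
    with hf
  set g : (Fin M → Fin 2) → ℝ := fun x => G (bitMask B x) - ∫ x, G (bitMask B x) ∂parityMeasure M 0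
    with hg
  have hcov : cov[F ∘ bitMask A, G ∘ bitMask B; parityMeasure M c] =
      c * ∑ x, (f x * g x * parity x) / 2 ^ M := by
    have h0 := covariance_parityMeasure_zero hAB F G
    simp only [covariance, Function.comp_apply] at h0 ⊢
    rw [hmean hA, hmean hB, integral_parityMeasure_eq_add, h0, zero_add, Finset.sum_div]
  refine ⟨fun hAB => ?_, ?_⟩
  · obtain ⟨i, hi⟩ := (Set.ne_univ_iff_exists_notMem _).1 hAB
    have hiA : i ∉ A := fun h => hi (Or.inl h)
    have hiB : i ∉ B := fun h => hi (Or.inr h)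
    rw [hcov, ← Finset.sum_div, sum_mul_parity_eq_zero i, zero_div, mul_zero]
    intro x
    simp only [hf, hg, bitMask_flipBit hiA, bitMask_flipBit hiB]
  · have hv : ∀ {A : Set (Fin M)} (F : (Fin M → Fin 2) → ℝ),
        Var[F ∘ bitMask A; parityMeasure M 0] = ∑ x, (F (bitMask A x) -
          ∫ x, F (bitMask A x) ∂parityMeasure M 0) ^ 2 / 2 ^ M := by
      intro A F
      rw [variance_eq_integral (measurable_of_finite _).aemeasurable,
        integral_parityMeasure (M := M) (c := 0)]
      refine Finset.sum_congr rfl fun x _ => ?_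
      simp only [parityWeight, Set.Icc.coe_zero, Function.comp_apply]
      ring
    rw [hvar hA, hvar hB, hcov, abs_mul, abs_of_nonneg c.2.1, hv, hv]
    refine mul_le_mul_of_nonneg_left ?_ c.2.1
    calc |∑ x, (f x * g x * parity x) / 2 ^ M|
        ≤ ∑ x, |(f x * g x * parity x) / 2 ^ M| := Finset.abs_sum_le_sum_abs _ _
      _ = ∑ x, (|f x| / √(2 ^ M)) * (|g x| / √(2 ^ M)) := by
        refine Finset.sum_congr rfl fun x _ => ?_
        rw [abs_div, abs_mul, abs_mul, abs_parity, div_mul_div_comm,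
          Real.mul_self_sqrt (by positivity), mul_one,
          abs_of_pos (show (0 : ℝ) < 2 ^ M by positivity)]
      _ ≤ √(∑ x, (|f x| / √(2 ^ M)) ^ 2) * √(∑ x, (|g x| / √(2 ^ M)) ^ 2) :=
        Real.sum_mul_le_sqrt_mul_sqrt _ _ _
      _ = _ := by
        simp only [div_pow, sq_abs, Real.sq_sqrt (show (0 : ℝ) ≤ 2 ^ M by positivity)]
        rfl

/-- Disjoint sets of bits have maximal correlation at most `c`, and are independent unless they
split the whole bit vector into two nonempty parts. -/
lemma maxCorrLE_bitMask [NeZero M] {A B : Set (Fin M)} (hAB : Disjoint A B) {r : ℝ} (hr : 0 ≤ r)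
    (h : A ∪ B = Set.univ → A.Nonempty → B.Nonempty → c ≤ r) :
    MaxCorrLE (parityMeasure M c) (bitMask A) (bitMask B) r := by
  intro F G _ _ _ _
  have hempty : ∀ (F : (Fin M → Fin 2) → ℝ), F ∘ bitMask (∅ : Set (Fin M)) = fun _ => F 0 := by
    intro F
    ext x
    exact congrArg F (funext fun i => by simp [bitMask])
  have zero : cov[F ∘ bitMask A, G ∘ bitMask B; parityMeasure M c] = 0 →
    |cov[F ∘ bitMask A, G ∘ bitMask B; parityMeasure M c]| ≤
      r * (√Var[F ∘ bitMask A; parityMeasure M c] * √Var[G ∘ bitMask B; parityMeasure M c]) := by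
    intro h
    rw [h, abs_zero]
    positivity
  rcases A.eq_empty_or_nonempty with rfl | hA
  · exact zero (by rw [hempty, covariance_const_left])
  rcases B.eq_empty_or_nonempty with rfl | hB
  · exact zero (by rw [hempty, covariance_const_right])
  have hA' : A ≠ Set.univ := by
    rintro rfl
    simp_all
  have hB' : B ≠ Set.univ := by
    rintro rfl
    simp_all
  have key := abs_covariance_parityMeasure_le (c := c) hAB hA' hB' F G
  by_cases hu : A ∪ B = Set.univ
  · exact key.2.trans (mul_le_mul_of_nonneg_right (h hu hA hB) (by positivity))
  · exact zero (key.1 hu)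

end Block

/-! ### Binary expansion of a uniform number -/

section BinaryExpansion

open scoped ENNReal

lemma measurable_digits : Measurable fun x : ℝ => Real.digits x 2 := by
  refine measurable_pi_lambda _ fun i => ?_
  exact measurable_from_nat.comp (Nat.measurable_floor.comp (by fun_prop))

lemma measurable_ofDigits : Measurable (Real.ofDigits (b := 2)) :=
  Real.continuous_ofDigits.measurable

/-- The points of the unit interval with prescribed first `n` binary digits have the same
`⌊2 ^ n * x⌋`, hence lie in one dyadic interval. -/
lemma volume_digits_cylinder_le (n : ℕ) (a : Fin n → Fin 2) :
    (volume.restrict (Set.Ico (0 : ℝ) 1)) {x | ∀ i : Fin n, Real.digits x 2 i = a i} ≤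
      ENNReal.ofReal ((2 ^ n)⁻¹) := by
  have hm : MeasurableSet {x : ℝ | ∀ i : Fin n, Real.digits x 2 i = a i} := by
    have : {x : ℝ | ∀ i : Fin n, Real.digits x 2 i = a i} =
        (fun x (i : Fin n) => Real.digits x 2 i) ⁻¹' {a} := by
      ext x
      simp [funext_iff]
    rw [this]
    exact (measurable_pi_lambda _ fun i => (measurable_pi_apply _).comp measurable_digits)
      (measurableSet_singleton a)
  rw [Measure.restrict_apply hm]
  rcases Set.eq_empty_or_nonempty ({x : ℝ | ∀ i : Fin n, Real.digits x 2 i = a i} ∩ Set.Ico 0 1)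
    with he | ⟨y, hy, hy1⟩
  · simp [he]
  have hsub : {x : ℝ | ∀ i : Fin n, Real.digits x 2 i = a i} ∩ Set.Ico 0 1 ⊆
      Set.Ico ((⌊2 ^ n * y⌋₊ : ℝ) / 2 ^ n) ((⌊2 ^ n * y⌋₊ + 1 : ℝ) / 2 ^ n) := by
    rintro x ⟨hx, hx1⟩
    have e : (⌊2 ^ n * x⌋₊ : ℝ) = ⌊2 ^ n * y⌋₊ := by
      have h1 := Real.ofDigits_digits_sum_eq (b := 2) hx1 n
      have h2 := Real.ofDigits_digits_sum_eq (b := 2) hy1 n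
      push_cast at h1 h2
      rw [← h1, ← h2]
      congr 1
      refine Finset.sum_congr rfl fun i hi => ?_
      have hi' := Finset.mem_range.1 hi
      rw [Real.ofDigitsTerm, Real.ofDigitsTerm, hx ⟨i, hi'⟩, hy ⟨i, hi'⟩]
    rw [← e, Set.mem_Ico, div_le_iff₀ (by positivity), lt_div_iff₀ (by positivity), mul_comm x]
    exact ⟨Nat.floor_le (mul_nonneg (by positivity) hx1.1), Nat.lt_floor_add_one _⟩
  refine (measure_mono hsub).trans (le_of_eq ?_)
  rw [Real.volume_Ico]
  congr 1
  field_simp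
  ring

/-- The binary digits of a uniform number are independent fair bits. -/
lemma map_digits_volume :
    (volume.restrict (Set.Ico (0 : ℝ) 1)).map (fun x => Real.digits x 2) =
      Measure.infinitePi fun _ : ℕ => fairBit := by
  have hprob : IsProbabilityMeasure (volume.restrict (Set.Ico (0 : ℝ) 1)) := ⟨by simp⟩
  have hfst : ∀ n : ℕ, Measurable fun (x : ℕ → Fin 2) (i : Fin n) => x i := fun n => by fun_prop
  have hν := Measure.isProbabilityMeasure_map (μ := volume.restrict (Set.Ico (0 : ℝ) 1))
    measurable_digits.aemeasurable
  set ν := (volume.restrict (Set.Ico (0 : ℝ) 1)).map fun x => Real.digits x 2 with hνdef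
  -- each cell of length `n` has mass at most `2⁻ⁿ`, and there are only `2 ^ n` of them
  have hcell : ∀ n : ℕ, ν.map (fun x (i : Fin n) => x i) =
      (Measure.infinitePi fun _ : ℕ => fairBit).map fun x (i : Fin n) => x i := by
    intro n
    have := Measure.isProbabilityMeasure_map (μ := ν) (hfst n).aemeasurable
    have hle : ∀ a ∈ Finset.univ, (ν.map fun x (i : Fin n) => x i).real {a} ≤ (2 ^ n)⁻¹ := by
      intro a _
      refine ENNReal.toReal_le_of_le_ofReal (by positivity) ?_
      rw [Measure.map_apply (hfst n) (measurableSet_singleton a), hνdef,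
        Measure.map_apply measurable_digits (hfst n (measurableSet_singleton a))]
      refine le_trans (le_of_eq ?_) (volume_digits_cylinder_le n a)
      congr 1
      ext x
      simp [funext_iff]
    have hsum : ∑ a, (ν.map fun x (i : Fin n) => x i).real {a} =
        ∑ a : Fin n → Fin 2, ((2 : ℝ) ^ n)⁻¹ := by
      rw [sum_measureReal_singleton]
      simp
    have heq := (Finset.sum_eq_sum_iff_of_le hle).1 hsum
    rw [Measure.map_infinitePi_infinitePi_of_inj Fin.val_injective]
    refine Measure.ext_of_singleton fun a => ?_
    rw [Measure.infinitePi_singleton_of_fintype,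
      ← ENNReal.toReal_eq_toReal_iff' (measure_ne_top _ _)
      (ENNReal.prod_ne_top fun i _ => measure_ne_top _ _)]
    refine (heq a (Finset.mem_univ a)).trans ?_
    simp [uniformOn_univ]
  refine Measure.eq_infinitePi _ fun s t ht => ?_
  obtain ⟨n, hn⟩ : ∃ n, ∀ i ∈ s, i < n := ⟨s.sup id + 1, fun i hi =>
    Nat.lt_succ_of_le (Finset.le_sup (f := id) hi)⟩
  have hpre : Set.pi s t = (fun (x : ℕ → Fin 2) (i : Fin n) => x i) ⁻¹'
      {y | ∀ i : Fin n, i.1 ∈ s → y i ∈ t i} := by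
    ext x
    exact ⟨fun h i hi => h i hi, fun h i hi => h ⟨i, hn i hi⟩ hi⟩
  have hms : MeasurableSet {y : Fin n → Fin 2 | ∀ i : Fin n, i.1 ∈ s → y i ∈ t i} :=
    (Set.toFinite _).measurableSet
  rw [hpre, ← Measure.map_apply (hfst n) hms, hcell, Measure.map_apply (hfst n) hms, ← hpre,
    Measure.infinitePi_pi _ fun i _ => ht i]

lemma map_ofDigits_fairBit :
    (Measure.infinitePi fun _ : ℕ => fairBit).map Real.ofDigits =
      volume.restrict (Set.Icc (0 : ℝ) 1) := by
  rw [← map_digits_volume, Measure.map_map measurable_ofDigits measurable_digits,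
    ← restrict_Ico_eq_restrict_Icc]
  conv_rhs => rw [← Measure.map_id (μ := volume.restrict (Set.Ico (0 : ℝ) 1))]
  refine Measure.map_congr ?_
  filter_upwards [ae_restrict_mem measurableSet_Ico] with x hx
  exact Real.ofDigits_digits one_lt_two hx

lemma ae_digits_ofDigits :
    ∀ᵐ y ∂(Measure.infinitePi fun _ : ℕ => fairBit), Real.digits (Real.ofDigits y) 2 = y := by
  have hms : MeasurableSet {y : ℕ → Fin 2 | Real.digits (Real.ofDigits y) 2 = y} :=
    measurableSet_eq_fun (measurable_digits.comp measurable_ofDigits) measurable_id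
  rw [← map_digits_volume, ae_map_iff measurable_digits.aemeasurable hms]
  filter_upwards [ae_restrict_mem measurableSet_Ico] with x hx
  rw [Real.ofDigits_digits one_lt_two hx]

end BinaryExpansion

/-! ### Dependence coefficients and maximal correlation -/

section Coefficients

variable {Ω α β : Type*} {𝒜 ℬ : MeasurableSpace Ω} [MeasurableSpace Ω] {P : Measure Ω}
  [MeasurableSpace α] [MeasurableSpace β] {U : Ω → α} {V : Ω → β} {c : ℝ}

lemma MaxCorrLE.abs_corr_le (h : MaxCorrLE P U V c) (hc : 0 ≤ c)
    (h𝒜 : 𝒜 ≤ MeasurableSpace.comap U inferInstance)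
    (hℬ : ℬ ≤ MeasurableSpace.comap V inferInstance) {f g : Ω → ℝ} (hf : Measurable[𝒜] f)
    (hg : Measurable[ℬ] g) (hf2 : MemLp f 2 P) (hg2 : MemLp g 2 P) : |corr P f g| ≤ c := by
  obtain ⟨F, hF, rfl⟩ := (hf.mono h𝒜 le_rfl).exists_eq_measurable_comp
  obtain ⟨G, hG, rfl⟩ := (hg.mono hℬ le_rfl).exists_eq_measurable_comp
  rw [corr, abs_div, abs_of_nonneg (by positivity :
    0 ≤ √Var[F ∘ U; P] * √Var[G ∘ V; P])]
  exact div_le_of_le_mul₀ (by positivity) hc (h F G hF hG hf2 hg2)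

lemma MaxCorrLE.rhoDep_le (h : MaxCorrLE P U V c) (hc : 0 ≤ c)
    (h𝒜 : 𝒜 ≤ MeasurableSpace.comap U inferInstance)
    (hℬ : ℬ ≤ MeasurableSpace.comap V inferInstance) : rhoDep 𝒜 ℬ P ≤ c := by
  refine Real.sSup_le ?_ hc
  rintro _ ⟨f, g, hf, hg, hf2, hg2, rfl⟩
  exact h.abs_corr_le hc h𝒜 hℬ hf hg hf2 hg2

variable [IsProbabilityMeasure P]

lemma memLp_indicator_one {A : Set Ω} (hA : MeasurableSet A) :
    MemLp (A.indicator (1 : Ω → ℝ)) 2 P :=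
  (memLp_const (1 : ℝ)).indicator hA

lemma covariance_indicator_one {A B : Set Ω} (hA : MeasurableSet A) (hB : MeasurableSet B) :
    cov[A.indicator (1 : Ω → ℝ), B.indicator (1 : Ω → ℝ); P] =
      P.real (A ∩ B) - P.real A * P.real B := by
  rw [covariance_eq_sub (memLp_indicator_one hA) (memLp_indicator_one hB),
    integral_indicator_one hA, integral_indicator_one hB, ← Set.inter_indicator_one,
    integral_indicator_one (hA.inter hB)]

lemma sqrt_variance_indicator_one_le {A : Set Ω} (hA : MeasurableSet A) :
    √Var[A.indicator (1 : Ω → ℝ); P] ≤ 1 / 2 := by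
  have h := variance_le_sq_of_bounded (μ := P) (X := A.indicator (1 : Ω → ℝ)) (a := 0) (b := 1)
    (.of_forall fun ω => by by_cases h : ω ∈ A <;> simp [h])
    (measurable_one.indicator hA).aemeasurable
  rw [sub_zero] at h
  exact (Real.sqrt_le_left (by norm_num)).2 h

/-- The correlation of two indicators is at least four times their covariance. -/
lemma four_mul_le_abs_corr {A B : Set Ω} (hA : MeasurableSet A) (hB : MeasurableSet B) :
    4 * |P.real (A ∩ B) - P.real A * P.real B| ≤
      |corr P (A.indicator (1 : Ω → ℝ)) (B.indicator (1 : Ω → ℝ))| := by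
  have h := abs_covariance_le_sqrt_variance_mul (memLp_indicator_one (P := P) hA)
    (memLp_indicator_one (P := P) hB)
  have hq : √Var[A.indicator (1 : Ω → ℝ); P] * √Var[B.indicator (1 : Ω → ℝ); P] ≤ 1 / 2 * (1 / 2) :=
    mul_le_mul (sqrt_variance_indicator_one_le hA) (sqrt_variance_indicator_one_le hB)
      (Real.sqrt_nonneg _) (by norm_num)
  have hq0 : 0 ≤ √Var[A.indicator (1 : Ω → ℝ); P] * √Var[B.indicator (1 : Ω → ℝ); P] := by
    positivity
  rw [← covariance_indicator_one hA hB, corr, abs_div, abs_of_nonneg hq0]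
  rcases hq0.eq_or_lt with h0 | h0
  · rw [← h0] at h ⊢
    simp [abs_nonpos_iff.1 (h.trans_eq rfl)]
  · rw [le_div_iff₀ h0]
    nlinarith [abs_nonneg cov[A.indicator (1 : Ω → ℝ), B.indicator (1 : Ω → ℝ); P]]

lemma MaxCorrLE.four_mul_le (h : MaxCorrLE P U V c) (hc : 0 ≤ c) (hU : Measurable U)
    (hV : Measurable V) (h𝒜 : 𝒜 ≤ MeasurableSpace.comap U inferInstance)
    (hℬ : ℬ ≤ MeasurableSpace.comap V inferInstance) {A B : Set Ω} (hA : MeasurableSet[𝒜] A)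
    (hB : MeasurableSet[ℬ] B) : 4 * |P.real (A ∩ B) - P.real A * P.real B| ≤ c := by
  have hA' := hU.comap_le _ (h𝒜 _ hA)
  have hB' := hV.comap_le _ (hℬ _ hB)
  refine (four_mul_le_abs_corr hA' hB').trans (h.abs_corr_le hc h𝒜 hℬ ?_ ?_
    (memLp_indicator_one hA') (memLp_indicator_one hB'))
  · exact Measurable.indicator (@measurable_const _ _ _ 𝒜 1) hA
  · exact Measurable.indicator (@measurable_const _ _ _ ℬ 1) hB

lemma MaxCorrLE.four_mul_alphaDep_le (h : MaxCorrLE P U V c) (hc : 0 ≤ c) (hU : Measurable U)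
    (hV : Measurable V) (h𝒜 : 𝒜 ≤ MeasurableSpace.comap U inferInstance)
    (hℬ : ℬ ≤ MeasurableSpace.comap V inferInstance) : 4 * alphaDep 𝒜 ℬ P ≤ c := by
  have : alphaDep 𝒜 ℬ P ≤ c / 4 := by
    refine Real.sSup_le ?_ (by positivity)
    rintro _ ⟨A, B, hA, hB, rfl⟩
    linarith [h.four_mul_le hc hU hV h𝒜 hℬ hA hB]
  linarith

lemma MaxCorrLE.le_alphaDep (h : MaxCorrLE P U V c) (hc : 0 ≤ c) (hU : Measurable U)
    (hV : Measurable V) (h𝒜 : 𝒜 ≤ MeasurableSpace.comap U inferInstance)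
    (hℬ : ℬ ≤ MeasurableSpace.comap V inferInstance) {A B : Set Ω} (hA : MeasurableSet[𝒜] A)
    (hB : MeasurableSet[ℬ] B) :
    |P.real (A ∩ B) - P.real A * P.real B| ≤ alphaDep 𝒜 ℬ P := by
  refine le_csSup ⟨c / 4, ?_⟩ ⟨A, B, hA, hB, rfl⟩
  rintro _ ⟨A, B, hA, hB, rfl⟩
  linarith [h.four_mul_le hc hU hV h𝒜 hℬ hA hB]

lemma MaxCorrLE.four_mul_le_rhoDep (h : MaxCorrLE P U V c) (hc : 0 ≤ c) (hU : Measurable U)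
    (hV : Measurable V) (h𝒜 : 𝒜 ≤ MeasurableSpace.comap U inferInstance)
    (hℬ : ℬ ≤ MeasurableSpace.comap V inferInstance) {A B : Set Ω} (hA : MeasurableSet[𝒜] A)
    (hB : MeasurableSet[ℬ] B) :
    4 * |P.real (A ∩ B) - P.real A * P.real B| ≤ rhoDep 𝒜 ℬ P := by
  have hA' := hU.comap_le _ (h𝒜 _ hA)
  have hB' := hV.comap_le _ (hℬ _ hB)
  refine (four_mul_le_abs_corr hA' hB').trans (le_csSup ⟨c, ?_⟩ ⟨_, _, ?_, ?_,
    memLp_indicator_one hA', memLp_indicator_one hB', rfl⟩)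
  · rintro _ ⟨f, g, hf, hg, hf2, hg2, rfl⟩
    exact h.abs_corr_le hc h𝒜 hℬ hf hg hf2 hg2
  · exact Measurable.indicator (@measurable_const _ _ _ 𝒜 1) hA
  · exact Measurable.indicator (@measurable_const _ _ _ ℬ 1) hB

end Coefficients

/-! ### Events of a block attaining the bound -/

section BlockEvent

variable {M : ℕ} {c : unitInterval}

/-- The event that the first bit is `0`. -/
def headEvent (M : ℕ) [NeZero M] : Set (Fin M → Fin 2) := {x | (-1 : ℝ) ^ (x 0 : ℕ) = 1}

/-- The event that the number of ones among the bits other than the first one is even. -/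
def tailEvent (M : ℕ) [NeZero M] : Set (Fin M → Fin 2) :=
  {x | ∏ i ∈ Finset.univ.erase 0, (-1 : ℝ) ^ (x i : ℕ) = 1}

/-- The first bit and the parity of the others attain the largest possible `α`. -/
lemma parityMeasure_real_head_inter_tail [NeZero M] (hM : 1 < M) :
    (parityMeasure M c).real (headEvent M ∩ tailEvent M) -
      (parityMeasure M c).real (headEvent M) * (parityMeasure M c).real (tailEvent M) = c / 4 := by
  set s : (Fin M → Fin 2) → ℝ := fun x => (-1) ^ (x 0 : ℕ) with hs
  set t : (Fin M → Fin 2) → ℝ := fun x => ∏ i ∈ Finset.univ.erase 0, (-1) ^ (x i : ℕ) with ht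
  have hst : ∀ x, s x * t x = parity x := fun x =>
    Finset.mul_prod_erase _ (fun i => (-1 : ℝ) ^ (x i : ℕ)) (Finset.mem_univ 0)
  have s1 : ∀ x, s x = 1 ∨ s x = -1 := fun x => neg_one_pow_eq_or ℝ _
  have t1 : ∀ x, t x = 1 ∨ t x = -1 := fun x => by
    refine Finset.prod_induction _ (fun r => r = 1 ∨ r = -1) ?_ (Or.inl rfl) fun i _ =>
      neg_one_pow_eq_or ℝ _
    rintro _ _ (rfl | rfl) (rfl | rfl) <;> norm_num
  have ss : ∀ x, s x * s x = 1 := fun x => by rcases s1 x with h | h <;> rw [h] <;> norm_num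
  have tt : ∀ x, t x * t x = 1 := fun x => by rcases t1 x with h | h <;> rw [h] <;> norm_num
  have sumt : ∑ x, t x = 0 := by
    have := sum_mul_parity_eq_zero (h := s) ⟨1, hM⟩ fun x => by
      have : (0 : Fin M) ≠ ⟨1, hM⟩ := fun h => by simpa using congrArg Fin.val h
      simp [hs, flipBit, this]
    simpa only [← hst, ← mul_assoc, ss, one_mul] using this
  have sums : ∑ x, s x = 0 := by
    have := sum_mul_parity_eq_zero (h := t) 0 fun x => by
      refine Finset.prod_congr rfl fun i hi => ?_
      rw [flipBit, Function.update_of_ne (Finset.ne_of_mem_erase hi)]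
    simpa only [← hst, mul_comm (s _), ← mul_assoc, tt, one_mul] using this
  have sump : ∑ x, s x * t x = 0 := by
    simp only [hst]
    exact sum_parity
  have A : ∀ x, (headEvent M).indicator (1 : (Fin M → Fin 2) → ℝ) x = (1 + s x) / 2 := fun x => by
    rcases s1 x with h | h
    · rw [Set.indicator_of_mem (show x ∈ headEvent M from h), h]
      norm_num
    · rw [Set.indicator_of_notMem (show x ∉ headEvent M from fun h' : s x = 1 => by linarith), h]
      norm_num
  have B : ∀ x, (tailEvent M).indicator (1 : (Fin M → Fin 2) → ℝ) x = (1 + t x) / 2 := fun x => by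
    rcases t1 x with h | h
    · rw [Set.indicator_of_mem (show x ∈ tailEvent M from h), h]
      norm_num
    · rw [Set.indicator_of_notMem (show x ∉ tailEvent M from fun h' : t x = 1 => by linarith), h]
      norm_num
  have AB : ∀ x, (headEvent M ∩ tailEvent M).indicator (1 : (Fin M → Fin 2) → ℝ) x =
      (1 + s x) / 2 * ((1 + t x) / 2) := fun x => by
    rw [← A, ← B, Set.inter_indicator_one]
    rfl
  have hc2 : ∑ _x : Fin M → Fin 2, (1 : ℝ) = 2 ^ M := by simp
  have eA : (parityMeasure M c).real (headEvent M) = 1 / 2 := by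
    rw [parityMeasure_real_apply]
    have : ∀ x : Fin M → Fin 2, parityWeight c x * (headEvent M).indicator 1 x =
        1 / (2 * 2 ^ M) * (1 + s x + c * (s x * t x) + c * t x) := fun x => by
      rw [A, parityWeight, ← hst]
      field_simp
      linear_combination (c : ℝ) * t x * ss x
    simp only [this, ← Finset.mul_sum, Finset.sum_add_distrib, sums, sumt, sump, hc2]
    field_simp
    ring
  have eB : (parityMeasure M c).real (tailEvent M) = 1 / 2 := by
    rw [parityMeasure_real_apply]
    have : ∀ x : Fin M → Fin 2, parityWeight c x * (tailEvent M).indicator 1 x =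
        1 / (2 * 2 ^ M) * (1 + t x + c * (s x * t x) + c * s x) := fun x => by
      rw [B, parityWeight, ← hst]
      field_simp
      linear_combination (c : ℝ) * s x * tt x
    simp only [this, ← Finset.mul_sum, Finset.sum_add_distrib, sums, sumt, sump, hc2]
    field_simp
    ring
  have eAB : (parityMeasure M c).real (headEvent M ∩ tailEvent M) = (1 + c) / 4 := by
    rw [parityMeasure_real_apply]
    have : ∀ x : Fin M → Fin 2, parityWeight c x * (headEvent M ∩ tailEvent M).indicator 1 x =
        (1 + c) / (4 * 2 ^ M) * (1 + s x + t x + s x * t x) := fun x => by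
      rw [AB, parityWeight, ← hst]
      field_simp
      linear_combination 4 * (c : ℝ) * (t x * (1 + t x) * ss x + (s x + 1) * tt x)
    simp only [this, ← Finset.mul_sum, Finset.sum_add_distrib, sums, sumt, sump, hc2]
    field_simp
    ring
  rw [eA, eB, eAB]
  ring

end BlockEvent

/-! ### The random field -/

section Construction

variable {d M : ℕ} (u₀ : Fin d) {γ : ℕ → unitInterval}

/-- A configuration: one bit vector of length `M` for every scale `n` and every base point of the
lattice. -/
abbrev Config (d M : ℕ) : Type := ℕ × (Fin d → ℤ) → Fin M → Fin 2

/-- The law of the blocks: they are independent, and those of scale `n` have parity bias `γ n`. -/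
def configMeasure (d M : ℕ) (γ : ℕ → unitInterval) : Measure (Config d M) :=
  Measure.infinitePi fun b => parityMeasure M (γ b.1)

/-- The displacement, from the base point of a block of scale `n`, of the site showing bit `i`. The
sites of a block form an arithmetic progression with step `n + 1` along the axis `u₀`. -/
def offset (n : ℕ) (i : Fin M) : Fin d → ℤ := Pi.single u₀ (((n : ℤ) + 1) * i)

/-- The bits shown at the site `k`: one for each scale and each position in the block. -/
def siteBits (k : Fin d → ℤ) (ω : Config d M) : ℕ × Fin M → Fin 2 :=
  fun p => ω (p.1, k - offset u₀ p.1 p.2) p.2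

/-- The number in `[0, 1]` whose binary digits are the given bits. -/
def encode [NeZero M] (y : ℕ × Fin M → Fin 2) : ℝ :=
  Real.ofDigits fun m => y (Nat.divModEquiv M m)

/-- The binary digits of a number, arranged as the bits of a site. -/
def decode [NeZero M] (x : ℝ) : ℕ × Fin M → Fin 2 :=
  fun p => Real.digits x 2 ((Nat.divModEquiv M).symm p)

/-- The random field: the value at `k` has as binary digits the bits shown at `k`. -/
def bitField [NeZero M] (k : Fin d → ℤ) (ω : Config d M) : ℝ := encode (siteBits u₀ k ω)

/-- The positions of the bits of the block `b` which are shown at sites of `S`. -/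
def visible (S : Set (Fin d → ℤ)) (b : ℕ × (Fin d → ℤ)) : Set (Fin M) :=
  {i | b.2 + offset u₀ b.1 i ∈ S}

/-- The configuration with all bits not shown at sites of `S` replaced by `0`. -/
def configMask (S : Set (Fin d → ℤ)) (ω : Config d M) : Config d M :=
  fun b => bitMask (visible u₀ S b) (ω b)

instance [NeZero M] : IsProbabilityMeasure (configMeasure d M γ) := by
  unfold configMeasure
  infer_instance

lemma measurable_siteBits (k : Fin d → ℤ) : Measurable (siteBits (M := M) u₀ k) := by
  unfold siteBits
  fun_prop

lemma measurable_encode [NeZero M] : Measurable (encode (M := M)) :=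
  measurable_ofDigits.comp (measurable_pi_lambda _ fun _ => measurable_pi_apply _)

lemma measurable_decode [NeZero M] : Measurable (decode (M := M)) :=
  measurable_pi_lambda _ fun _ => (measurable_pi_apply _).comp measurable_digits

lemma measurable_bitField [NeZero M] (k : Fin d → ℤ) : Measurable (bitField (M := M) u₀ k) :=
  measurable_encode.comp (measurable_siteBits u₀ k)

lemma measurable_configMask (S : Set (Fin d → ℤ)) : Measurable (configMask (M := M) u₀ S) :=
  measurable_pi_lambda _ fun b => (measurable_of_finite (bitMask _)).comp (measurable_pi_apply b)

lemma siteBits_configMask {S : Set (Fin d → ℤ)} {k : Fin d → ℤ} (hk : k ∈ S) (ω : Config d M) :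
    siteBits u₀ k (configMask u₀ S ω) = siteBits u₀ k ω := by
  ext p
  simp [siteBits, configMask, bitMask, visible, hk]

lemma sigmaField_le_comap_configMask [NeZero M] (S : Set (Fin d → ℤ)) :
    sigmaField (bitField (M := M) u₀) S ≤
      MeasurableSpace.comap (configMask u₀ S) inferInstance := by
  refine iSup₂_le fun k hk => ?_
  have : bitField (M := M) u₀ k = bitField u₀ k ∘ configMask u₀ S := by
    ext ω
    simp [bitField, siteBits_configMask u₀ hk]
  rw [this, ← MeasurableSpace.comap_comp]
  exact MeasurableSpace.comap_mono (measurable_bitField u₀ k).comap_le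

section Law

/-- A set of sites which shows no block completely does not see the parity biases. -/
lemma configMeasure_map_configMask [NeZero M] {S : Set (Fin d → ℤ)}
    (hS : ∀ b, visible (M := M) u₀ S b ≠ Set.univ) :
    (configMeasure d M γ).map (configMask u₀ S) =
      (configMeasure d M fun _ => 0).map (configMask u₀ S) := by
  have h : ∀ γ : ℕ → unitInterval, (configMeasure d M γ).map (configMask u₀ S) =
      Measure.infinitePi fun b => (parityMeasure M (γ b.1)).map (bitMask (visible u₀ S b)) :=
    fun γ => Measure.infinitePi_map_pi _ fun b => measurable_of_finite _
  rw [h, h]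
  simp only [parityMeasure_map_bitMask (hS _)]

/-- Without bias all the bits of all the sites are independent and fair. -/
lemma map_siteBits_of_zero [NeZero M] :
    (configMeasure d M fun _ => 0).map (fun ω k => siteBits u₀ k ω) =
      Measure.infinitePi fun _ : Fin d → ℤ =>
        Measure.infinitePi fun _ : ℕ × Fin M => fairBit := by
  have hinj : Function.Injective fun q : (Fin d → ℤ) × (ℕ × Fin M) =>
      ((q.2.1, q.1 - offset u₀ q.2.1 q.2.2), q.2.2) := by
    rintro ⟨k, n, i⟩ ⟨k', n', i'⟩ h
    simp only [Prod.mk.injEq] at h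
    obtain ⟨⟨rfl, h⟩, rfl⟩ := h
    simpa using h
  rw [← Measure.infinitePi_map_curry fun _ _ => fairBit,
    ← Measure.map_infinitePi_infinitePi_of_inj (P := fun _ => fairBit) hinj,
    ← Measure.infinitePi_map_curry_symm fun _ _ => fairBit, Measure.map_map (by fun_prop)
    (by fun_prop), Measure.map_map (by fun_prop) (by fun_prop)]
  simp only [configMeasure, parityMeasure_zero]
  rfl

variable {u₀} in
lemma offset_injective (n : ℕ) : Function.Injective (offset (M := M) u₀ n) := by
  intro i j h
  have h := congrFun h u₀
  simp only [offset, Pi.single_eq_same] at h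
  have h' := mul_left_cancel₀ (by positivity) h
  exact Fin.ext (by exact_mod_cast h')

/-- Fewer than `M` sites show independent fair bits: they cannot show a block completely. -/
lemma map_siteBits [NeZero M] {N : ℕ} (hN : N < M) {k : Fin N → Fin d → ℤ}
    (hk : Function.Injective k) :
    (configMeasure d M γ).map (fun ω l => siteBits u₀ (k l) ω) =
      Measure.infinitePi fun _ : Fin N => Measure.infinitePi fun _ : ℕ × Fin M => fairBit := by
  have hvis : ∀ b, visible (M := M) u₀ (Set.range k) b ≠ Set.univ := by
    intro b hb
    have h : ∀ i : Fin M, ∃ l, k l = b.2 + offset u₀ b.1 i := fun i =>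
      (hb ▸ Set.mem_univ i : i ∈ visible (M := M) u₀ (Set.range k) b)
    choose l hl using h
    have hinj : Function.Injective l := fun i j hij =>
      offset_injective b.1 (add_left_cancel ((hl i).symm.trans ((congrArg k hij).trans (hl j))))
    have := Fintype.card_le_of_injective l hinj
    simp only [Fintype.card_fin] at this
    omega
  have hm : Measurable fun (ω : Config d M) l => siteBits u₀ (k l) ω :=
    measurable_pi_lambda _ fun l => measurable_siteBits u₀ (k l)
  have hm' : Measurable fun (ω : Config d M) k => siteBits u₀ k ω :=
    measurable_pi_lambda _ fun k => measurable_siteBits u₀ k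
  have hfac : (fun (ω : Config d M) l => siteBits u₀ (k l) ω) =
      (fun ω l => siteBits u₀ (k l) ω) ∘ configMask u₀ (Set.range k) := by
    ext ω l : 2
    exact (siteBits_configMask u₀ (Set.mem_range_self l) ω).symm
  rw [hfac, ← Measure.map_map hm (measurable_configMask u₀ _), configMeasure_map_configMask u₀ hvis,
    Measure.map_map hm (measurable_configMask u₀ _), ← hfac,
    ← Measure.map_infinitePi_infinitePi_of_inj (P := fun _ : Fin d → ℤ =>
      Measure.infinitePi fun _ : ℕ × Fin M => fairBit) hk, ← map_siteBits_of_zero u₀,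
    Measure.map_map (by fun_prop) hm']
  rfl

lemma map_siteBits_single [NeZero M] (hM : 1 < M) (k : Fin d → ℤ) :
    (configMeasure d M γ).map (siteBits u₀ k) =
      Measure.infinitePi fun _ : ℕ × Fin M => fairBit := by
  have h := map_siteBits (γ := γ) u₀ hM (k := fun _ => k) (Function.injective_of_subsingleton _)
  have h' := congrArg (Measure.map fun x : Fin 1 → ℕ × Fin M → Fin 2 => x 0) h
  rw [Measure.infinitePi_map_eval, Measure.map_map (by fun_prop)
    (measurable_pi_lambda _ fun l => measurable_siteBits u₀ k)] at h'
  exact h'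

lemma tuplewiseIndependent_bitField [NeZero M] {N : ℕ} (hM : 1 < M) (hN : N < M) :
    TuplewiseIndependent (configMeasure d M γ) (bitField (M := M) u₀) N := by
  intro k hk
  have h : iIndepFun (fun l => siteBits u₀ (k l)) (configMeasure d M γ) := by
    rw [iIndepFun_iff_map_fun_eq_infinitePi_map fun l => measurable_siteBits u₀ (k l),
      map_siteBits u₀ hN hk]
    simp only [map_siteBits_single u₀ hM]
  exact h.comp _ fun _ => measurable_encode

lemma map_reindex_fairBit [NeZero M] :
    (Measure.infinitePi fun _ : ℕ × Fin M => fairBit).map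
      (fun y m => y (Nat.divModEquiv M m)) = Measure.infinitePi fun _ : ℕ => fairBit :=
  Measure.map_infinitePi_infinitePi_of_inj (P := fun _ => fairBit) (Nat.divModEquiv M).injective

lemma isUniform_bitField [NeZero M] (hM : 1 < M) (k : Fin d → ℤ) :
    pdf.IsUniform (bitField (M := M) u₀ k) (Set.Icc (0 : ℝ) 1) (configMeasure d M γ) volume := by
  have hm : Measurable fun (y : ℕ × Fin M → Fin 2) m => y (Nat.divModEquiv M m) := by fun_prop
  have : (bitField (M := M) u₀ k) = Real.ofDigits ∘ (fun y m => y (Nat.divModEquiv M m)) ∘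
    siteBits u₀ k := rfl
  rw [pdf.IsUniform, this, ← Measure.map_map measurable_ofDigits
    (hm.comp (measurable_siteBits u₀ k)), ← Measure.map_map hm (measurable_siteBits u₀ k),
    map_siteBits_single u₀ hM, map_reindex_fairBit, map_ofDigits_fairBit]
  simp [ProbabilityTheory.cond]

/-- The bits shown at a site can almost surely be read off the value of the field. -/
lemma ae_decode_bitField [NeZero M] (hM : 1 < M) (k : Fin d → ℤ) :
    ∀ᵐ ω ∂configMeasure d M γ, decode (bitField u₀ k ω) = siteBits u₀ k ω := by
  have hm : Measurable fun (y : ℕ × Fin M → Fin 2) m => y (Nat.divModEquiv M m) := by fun_prop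
  have h := ae_digits_ofDigits
  rw [← map_reindex_fairBit (M := M), ← map_siteBits_single (γ := γ) u₀ hM k] at h
  have h' := ae_of_ae_map (measurable_siteBits u₀ k).aemeasurable
    (ae_of_ae_map hm.aemeasurable h)
  filter_upwards [h'] with ω hω
  ext p : 1
  exact (congrFun hω _).trans (congrArg _ (Equiv.apply_symm_apply _ p))

lemma strictlyStationary_bitField [NeZero M] :
    StrictlyStationary (configMeasure d M γ) (bitField (M := M) u₀) := by
  intro v
  have hinj : Function.Injective fun b : ℕ × (Fin d → ℤ) => (b.1, b.2 + v) := by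
    rintro ⟨n, k⟩ ⟨n', k'⟩ h
    simpa using h
  have hshift : (configMeasure d M γ).map (fun ω b => ω (b.1, b.2 + v)) = configMeasure d M γ :=
    Measure.map_infinitePi_infinitePi_of_inj (P := fun b : ℕ × (Fin d → ℤ) =>
      parityMeasure M (γ b.1)) hinj
  have hX : Measurable fun (ω : Config d M) k => bitField u₀ k ω :=
    measurable_pi_lambda _ fun k => measurable_bitField u₀ k
  refine ⟨(measurable_pi_lambda _ fun k => measurable_bitField u₀ _).aemeasurable,
    hX.aemeasurable, ?_⟩
  conv_rhs => rw [← hshift, Measure.map_map hX (by fun_prop)]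
  congr 1
  ext ω k
  simp only [bitField, Function.comp_apply]
  congr 1
  ext p : 1
  simp only [siteBits]
  rw [sub_add_eq_add_sub]

end Law

end Construction

/-! ### Sets of sites at a positive distance -/

section Separation

variable {d : ℕ}

lemma abs_apply_le_latticeNorm (x : Fin d → ℤ) (u : Fin d) : |(x u : ℝ)| ≤ latticeNorm x :=
  Real.abs_le_sqrt (Finset.single_le_sum (f := fun u => (x u : ℝ) ^ 2) (fun _ _ => sq_nonneg _)
    (Finset.mem_univ u))

lemma latticeNorm_single (u : Fin d) (a : ℤ) : latticeNorm (Pi.single u a) = |(a : ℝ)| := by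
  rw [latticeNorm, Finset.sum_eq_single u]
  · rw [Pi.single_eq_same, Real.sqrt_sq_eq_abs]
  · intro v _ hv
    simp [Pi.single_eq_of_ne hv]
  · simp

/-- Any point of `S` is at distance at least `r` from any point of `T`. -/
def Separated (S T : Set (Fin d → ℤ)) (r : ℝ) : Prop :=
  ∀ s ∈ S, ∀ t ∈ T, r ≤ latticeNorm (s - t)

lemma separated_of_le_latticeDist {S T : Set (Fin d → ℤ)} {r : ℝ} (h : r ≤ latticeDist S T) :
    Separated S T r := fun s hs t ht =>
  h.trans (csInf_le ⟨0, by rintro _ ⟨s, -, t, -, rfl⟩; exact Real.sqrt_nonneg _⟩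
    ⟨s, hs, t, ht, rfl⟩)

lemma separated_of_forall_abs_sub {S T : Set (Fin d → ℤ)} {r : ℝ} (u : Fin d)
    (h : ∀ s ∈ S, ∀ t ∈ T, r ≤ |(s u : ℝ) - t u|) : Separated S T r := fun s hs t ht =>
  (h s hs t ht).trans (by simpa using abs_apply_le_latticeNorm (s - t) u)

lemma separated_of_le_intDist {G H : Set ℤ} {r : ℝ} (h : r ≤ intDist G H) (u : Fin d) :
    Separated {k | k u ∈ G} {k | k u ∈ H} r :=
  separated_of_forall_abs_sub u fun s hs t ht =>
    h.trans (csInf_le ⟨0, by rintro _ ⟨s, -, t, -, rfl⟩; exact abs_nonneg _⟩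
      ⟨s u, hs, t u, ht, rfl⟩)

lemma separated_halfSpaces (j : ℤ) (n : ℕ) (u : Fin d) :
    Separated {k | k u ≤ j} {k | j + n ≤ k u} n := by
  refine separated_of_forall_abs_sub u fun s hs t ht => ?_
  have h1 : (s u : ℝ) ≤ j := by exact_mod_cast hs
  have h2 : (j : ℝ) + n ≤ t u := by exact_mod_cast ht
  rw [abs_sub_comm]
  exact le_trans (by linarith) (le_abs_self _)

end Separation

/-! ### Bounds for the dependence coefficients of the field -/

section Bounds

variable {d M : ℕ} (u₀ : Fin d) {γ : ℕ → unitInterval}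

/-- A set of positions which is neither empty nor everything has two neighbouring positions of
which exactly one is in the set. -/
lemma exists_succ_mem_not_iff {A : Set (Fin M)} (hA : A.Nonempty) (hA' : A ≠ Set.univ) :
    ∃ i j : Fin M, (j : ℕ) = i + 1 ∧ ¬(i ∈ A ↔ j ∈ A) := by
  by_contra! h
  obtain ⟨a, ha⟩ := hA
  obtain ⟨b, hb⟩ := (Set.ne_univ_iff_exists_notMem A).1 hA'
  have h0 : ∀ (m : ℕ) (hm : m < M), ((⟨m, hm⟩ : Fin M) ∈ A ↔ (⟨0, by omega⟩ : Fin M) ∈ A) := by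
    intro m
    induction m with
    | zero => exact fun _ => Iff.rfl
    | succ m ih => exact fun hm => (h ⟨m, by omega⟩ ⟨m + 1, hm⟩ rfl).symm.trans (ih _)
  exact hb ((h0 b b.2).2 ((h0 a a.2).1 ha))

/-- A block split between two separated sets of sites has a large scale, since two neighbouring
sites of the block belong to different sets. -/
lemma le_scale_of_visible_union {S T : Set (Fin d → ℤ)} {n : ℕ} (hn : 1 ≤ n)
    (hST : Separated S T n) {b : ℕ × (Fin d → ℤ)}
    (hu : visible (M := M) u₀ S b ∪ visible u₀ T b = Set.univ)
    (hS : (visible (M := M) u₀ S b).Nonempty) (hT : (visible (M := M) u₀ T b).Nonempty) :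
    n - 1 ≤ b.1 := by
  have hdis : ∀ i : Fin M, i ∈ visible u₀ S b → i ∈ visible u₀ T b → False := fun i hi hi' => by
    have := hST _ hi _ hi'
    simp only [sub_self, latticeNorm, Pi.zero_apply, Int.cast_zero] at this
    norm_num at this
    omega
  have hdist : ∀ i j : Fin M, (j : ℕ) = i + 1 ∨ (i : ℕ) = j + 1 → i ∈ visible u₀ S b →
      j ∈ visible u₀ T b → n - 1 ≤ b.1 := fun i j hij hi hj => by
    have h := hST _ hi _ hj
    rw [add_sub_add_left_eq_sub, offset, offset, ← Pi.single_sub, latticeNorm_single, ← mul_sub]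
      at h
    have h1 : |(((b.1 : ℤ) + 1) * ((i : ℤ) - (j : ℤ)) : ℤ)| = (b.1 : ℤ) + 1 := by
      rw [abs_mul, abs_of_nonneg (by positivity : (0 : ℤ) ≤ (b.1 : ℤ) + 1)]
      rcases hij with hij | hij <;> simp [hij]
    have h2 : (n : ℤ) ≤ (b.1 : ℤ) + 1 := by
      rw [← h1]
      exact_mod_cast h
    omega
  have hS' : visible (M := M) u₀ S b ≠ Set.univ := by
    intro h
    obtain ⟨i, hi⟩ := hT
    exact hdis i (h ▸ Set.mem_univ i) hi
  have hmem : ∀ i : Fin M, i ∉ visible u₀ S b → i ∈ visible u₀ T b := fun i hi =>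
    (hu ▸ Set.mem_univ i : i ∈ visible u₀ S b ∪ visible u₀ T b).resolve_left hi
  obtain ⟨i, j, hij, h⟩ := exists_succ_mem_not_iff hS hS'
  by_cases hi : i ∈ visible u₀ S b
  · exact hdist i j (.inl hij) hi (hmem j fun hj => h (iff_of_true hi hj))
  · exact hdist j i (.inr hij) (by_contra fun hj => h (iff_of_false hi hj)) (hmem i hi)

/-- The bits shown at sets of sites at distance at least `n` have maximal correlation at most the
bias of the blocks of step `n`. -/
lemma maxCorrLE_configMask [NeZero M] (hγ : Antitone γ) {S T : Set (Fin d → ℤ)} {n : ℕ}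
    (hn : 1 ≤ n) (hST : Separated S T n) :
    MaxCorrLE (configMeasure d M γ) (configMask u₀ S) (configMask u₀ T) (γ (n - 1)) := by
  have hev : ∀ b : ℕ × (Fin d → ℤ), Measurable fun ω : Config d M => ω b := fun b => by fun_prop
  refine maxCorrLE_pi (U := fun b (ω : Config d M) => bitMask (visible u₀ S b) (ω b))
    (V := fun b (ω : Config d M) => bitMask (visible u₀ T b) (ω b))
    (fun b => (measurable_of_finite (bitMask _)).comp (hev b))
    (fun b => (measurable_of_finite (bitMask _)).comp (hev b)) (γ (n - 1)).2.1 (fun b => ?_) ?_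
  · have hdis : Disjoint (visible (M := M) u₀ S b) (visible u₀ T b) := by
      rw [Set.disjoint_left]
      intro i hi hi'
      have := hST _ hi _ hi'
      simp only [sub_self, latticeNorm, Pi.zero_apply, Int.cast_zero] at this
      norm_num at this
      omega
    have h := maxCorrLE_bitMask (c := γ b.1) hdis (γ (n - 1)).2.1 fun hu hS hT =>
      hγ (le_scale_of_visible_union u₀ hn hST hu hS hT)
    rw [← Measure.infinitePi_map_eval (fun b : ℕ × (Fin d → ℤ) => parityMeasure M (γ b.1)) b,
      maxCorrLE_map_iff (hev b) (measurable_of_finite _) (measurable_of_finite _)] at h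
    exact h
  · exact iIndepFun_infinitePi (X := fun b x => (bitMask (visible u₀ S b) x,
      bitMask (visible u₀ T b) x)) fun b => measurable_of_finite _

/-- If `S` shows the first bit of the block of step `n + 1` based at the origin, and `T` shows the
other ones, then the dependence coefficients are bounded below by means of this block. -/
lemma exists_events_of_visible [NeZero M] (hM : 1 < M) {S T : Set (Fin d → ℤ)} (n : ℕ)
    (hS : 0 ∈ S) (hT : ∀ i : Fin M, i ≠ 0 → offset u₀ n i ∈ T) :
    ∃ A B : Set (Config d M), MeasurableSet[sigmaField (bitField u₀) S] A ∧
      MeasurableSet[sigmaField (bitField u₀) T] B ∧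
      4 * |(configMeasure d M γ).real (A ∩ B) -
        (configMeasure d M γ).real A * (configMeasure d M γ).real B| = γ n := by
  have hX : ∀ {S : Set (Fin d → ℤ)} {k : Fin d → ℤ}, k ∈ S →
      Measurable[sigmaField (bitField (M := M) u₀) S] (bitField (M := M) u₀ k) := fun {S k} hk =>
    Measurable.of_comap_le (le_iSup₂_of_le (f := fun k (_ : k ∈ S) =>
      MeasurableSpace.comap (bitField (M := M) u₀ k) inferInstance) k hk le_rfl)
  -- the bits of the block, read off the values of the field
  let D : Config d M → Fin M → Fin 2 := fun ω i => decode (bitField u₀ (offset u₀ n i) ω) (n, i)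
  have hDm : ∀ {S : Set (Fin d → ℤ)} {i : Fin M}, offset u₀ n i ∈ S →
      Measurable[sigmaField (bitField (M := M) u₀) S] fun ω => D ω i := fun {S i} hi =>
    ((measurable_pi_apply _).comp measurable_decode).comp (hX hi)
  have h0 : offset (M := M) u₀ n 0 = 0 := by simp [offset]
  have hDae : ∀ᵐ ω ∂configMeasure d M γ, D ω = ω (n, 0) := by
    have : ∀ᵐ ω ∂configMeasure d M γ, ∀ i : Fin M,
        decode (bitField u₀ (offset u₀ n i) ω) = siteBits u₀ (offset u₀ n i) ω :=
      ae_all_iff.2 fun i => ae_decode_bitField u₀ hM _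
    filter_upwards [this] with ω hω
    ext i : 1
    simp [D, hω, siteBits]
  have hreal : ∀ E : Set (Fin M → Fin 2), (configMeasure d M γ).real (D ⁻¹' E) =
      (parityMeasure M (γ n)).real E := fun E => by
    have h1 : (configMeasure d M γ).real (D ⁻¹' E) =
        (configMeasure d M γ).real ((fun ω => ω (n, 0)) ⁻¹' E) := by
      refine measureReal_congr ?_
      filter_upwards [hDae] with ω hω
      exact congrArg E hω
    rw [h1, ← map_measureReal_apply (by fun_prop) (Set.toFinite E).measurableSet, configMeasure,
      Measure.infinitePi_map_eval]
  refine ⟨D ⁻¹' headEvent M, D ⁻¹' tailEvent M, ?_, ?_, ?_⟩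
  · have hm := hDm (S := S) (i := 0) (h0 ▸ hS)
    exact hm (Set.toFinite {a : Fin 2 | (-1 : ℝ) ^ (a : ℕ) = 1}).measurableSet
  · have hm : Measurable[sigmaField (bitField (M := M) u₀) T]
        fun ω (i : {i : Fin M // i ≠ 0}) => D ω i :=
      @measurable_pi_lambda _ _ _ (sigmaField (bitField (M := M) u₀) T) _ _
        fun i => hDm (hT i.1 i.2)
    have hfac : D ⁻¹' tailEvent M = (fun ω (i : {i : Fin M // i ≠ 0}) => D ω i) ⁻¹'
        {y | ∏ i, (-1 : ℝ) ^ (y i : ℕ) = 1} := by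
      ext ω
      simp only [tailEvent, Set.mem_preimage, Set.mem_ofPred_eq]
      rw [Finset.prod_subtype (p := fun i : Fin M => i ≠ 0) (Finset.univ.erase 0) (by simp)
        fun i => (-1 : ℝ) ^ (D ω i : ℕ)]
    rw [hfac]
    exact hm (Set.toFinite _).measurableSet
  · rw [← Set.preimage_inter, hreal, hreal, hreal, parityMeasure_real_head_inter_tail hM,
      abs_of_nonneg (div_nonneg (γ n).2.1 (by norm_num))]
    ring

end Bounds

end RandomFieldMixing

end

/-! ### Existence of the field -/

theorem theorem1p4 (d N : ℕ) (hd : 1 ≤ d) (hN : 2 ≤ N) (c : ℕ → ℝ)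
    (hc : ∀ n : ℕ, 1 ≤ n → c n ∈ Set.Icc (0 : ℝ) 1)
    (hmono : ∀ m n : ℕ, 1 ≤ m → m ≤ n → c n ≤ c m) :
    ∃ (Ω : Type) (_ : MeasurableSpace Ω) (P : Measure Ω) (X : (Fin d → ℤ) → Ω → ℝ),
      IsProbabilityMeasure P ∧
      (∀ k, Measurable (X k)) ∧
      RandomFieldMixing.StrictlyStationary P X ∧
      pdf.IsUniform (X 0) (Set.Icc (0 : ℝ) 1) P volume ∧
      RandomFieldMixing.TuplewiseIndependent P X N ∧
      ∀ n : ℕ, 1 ≤ n →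
        4 * RandomFieldMixing.alphaCoeff P X n = c n ∧
        RandomFieldMixing.rhoCoeff P X n = c n ∧
        RandomFieldMixing.rhoPrimeCoeff P X n = c n ∧
        RandomFieldMixing.rhoStarCoeff P X n = c n := by
  open RandomFieldMixing in
  let u₀ : Fin d := ⟨0, hd⟩
  let γ : ℕ → unitInterval := fun n => ⟨c (n + 1), hc _ (by omega)⟩
  have hγ : Antitone γ := fun m n hmn => hmono _ _ (by omega) (by omega)
  have hM : 1 < N + 1 := by omega
  refine ⟨Config d (N + 1), inferInstance, configMeasure d (N + 1) γ, bitField u₀, inferInstance,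
    measurable_bitField u₀, strictlyStationary_bitField u₀, isUniform_bitField u₀ hM 0,
    tuplewiseIndependent_bitField u₀ hM (by omega), fun n hn => ?_⟩
  -- blocks are numbered from scale `0`, which has step `1`
  have hγn : (γ (n - 1) : ℝ) = c n := by
    simp only [γ]
    congr 1
    omega
  have hc0 : 0 ≤ c n := (hc n hn).1
  -- upper bounds for all separated pairs
  have hmax : ∀ {S T : Set (Fin d → ℤ)}, Separated S T n →
      MaxCorrLE (configMeasure d (N + 1) γ) (configMask u₀ S) (configMask u₀ T) (c n) :=
    fun h => hγn ▸ maxCorrLE_configMask u₀ hγ hn h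
  have hrho : ∀ {S T : Set (Fin d → ℤ)}, Separated S T n → rhoDep (sigmaField (bitField u₀) S)
      (sigmaField (bitField u₀) T) (configMeasure d (N + 1) γ) ≤ c n := fun h =>
    (hmax h).rhoDep_le hc0 (sigmaField_le_comap_configMask u₀ _)
      (sigmaField_le_comap_configMask u₀ _)
  have halpha : ∀ {S T : Set (Fin d → ℤ)}, Separated S T n →
      alphaDep (sigmaField (bitField u₀) S) (sigmaField (bitField u₀) T)
        (configMeasure d (N + 1) γ) ≤ c n / 4 := fun h => by
    linarith [(hmax h).four_mul_alphaDep_le hc0 (measurable_configMask u₀ _)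
      (measurable_configMask u₀ _) (sigmaField_le_comap_configMask u₀ _)
      (sigmaField_le_comap_configMask u₀ _)]
  -- lower bounds from one pair of half-spaces
  have hsep := separated_halfSpaces 0 n u₀
  obtain ⟨A, B, hA, hB, hAB⟩ := exists_events_of_visible (γ := γ) u₀ hM (n - 1)
    (S := {k | k u₀ ≤ 0}) (T := {k | 0 + (n : ℤ) ≤ k u₀}) (by simp) fun i hi => by
      have hi1 : (1 : ℤ) ≤ (i : ℕ) := by
        have : (i : ℕ) ≠ 0 := fun h => hi (Fin.ext (by simpa using h))
        omega
      have hn1 : ((n - 1 : ℕ) : ℤ) + 1 = n := by omega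
      simp only [Set.mem_ofPred_eq, offset, Pi.single_eq_same, hn1, zero_add]
      nlinarith
  rw [hγn] at hAB
  have lrho := (hmax hsep).four_mul_le_rhoDep hc0 (measurable_configMask u₀ _)
      (measurable_configMask u₀ _) (sigmaField_le_comap_configMask u₀ _)
      (sigmaField_le_comap_configMask u₀ _) hA hB
  have lalpha := (hmax hsep).le_alphaDep hc0 (measurable_configMask u₀ _)
      (measurable_configMask u₀ _) (sigmaField_le_comap_configMask u₀ _)
      (sigmaField_le_comap_configMask u₀ _) hA hB
  rw [hAB] at lrho
  have hne : ({k : Fin d → ℤ | k u₀ ≤ 0}).Nonempty := ⟨0, by simp⟩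
  have hne' : ({k : Fin d → ℤ | 0 + (n : ℤ) ≤ k u₀}).Nonempty := ⟨fun _ => n, by simp⟩
  have hdis : Disjoint {k : Fin d → ℤ | k u₀ ≤ 0} {k | 0 + (n : ℤ) ≤ k u₀} := by
    rw [Set.disjoint_left]
    intro k hk hk'
    simp only [Set.mem_ofPred_eq] at hk hk'
    omega
  refine ⟨?_, ?_, ?_, ?_⟩
  · have h1 : alphaCoeff (configMeasure d (N + 1) γ) (bitField u₀) n ≤ c n / 4 := by
      refine Real.sSup_le ?_ (by positivity)
      rintro _ ⟨j, u, rfl⟩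
      exact halpha (separated_halfSpaces j n u)
    have h2 : c n / 4 ≤ alphaCoeff (configMeasure d (N + 1) γ) (bitField u₀) n := by
      refine le_trans (by linarith) (le_csSup ⟨c n / 4, ?_⟩ ⟨0, u₀, rfl⟩)
      rintro _ ⟨j, u, rfl⟩
      exact halpha (separated_halfSpaces j n u)
    linarith
  · refine le_antisymm (Real.sSup_le ?_ hc0) (lrho.trans (le_csSup ⟨c n, ?_⟩ ⟨0, u₀, rfl⟩)) <;>
    · rintro _ ⟨j, u, rfl⟩
      exact hrho (separated_halfSpaces j n u)
  · refine le_antisymm (Real.sSup_le ?_ hc0) (lrho.trans (le_csSup ⟨c n, ?_⟩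
      ⟨u₀, Set.Iic 0, Set.Ici (0 + (n : ℤ)), Set.nonempty_Iic, Set.nonempty_Ici, ?_, ?_, rfl⟩))
    · rintro _ ⟨u, G, H, -, -, -, hGH, rfl⟩
      exact hrho (separated_of_le_intDist hGH u)
    · rintro _ ⟨u, G, H, -, -, -, hGH, rfl⟩
      exact hrho (separated_of_le_intDist hGH u)
    · rw [Set.disjoint_left]
      intro g hg hg'
      simp only [Set.mem_Iic, Set.mem_Ici] at hg hg'
      omega
    · refine le_csInf ⟨_, 0, Set.mem_Iic.2 le_rfl, 0 + (n : ℤ), Set.mem_Ici.2 le_rfl, rfl⟩ ?_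
      rintro _ ⟨g, hg, h, hh, rfl⟩
      have h1 : (g : ℝ) ≤ 0 := by exact_mod_cast hg
      have h2 : (n : ℝ) ≤ h := by simpa using (by exact_mod_cast hh : ((0 + (n : ℤ) : ℤ) : ℝ) ≤ h)
      rw [abs_sub_comm]
      exact le_trans (by linarith) (le_abs_self _)
  · refine le_antisymm (Real.sSup_le ?_ hc0) (lrho.trans (le_csSup ⟨c n, ?_⟩
      ⟨_, _, hne, hne', hdis, ?_, rfl⟩))
    · rintro _ ⟨S, T, -, -, -, hST, rfl⟩
      exact hrho (separated_of_le_latticeDist hST)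
    · rintro _ ⟨S, T, -, -, -, hST, rfl⟩
      exact hrho (separated_of_le_latticeDist hST)
    · obtain ⟨s, hs⟩ := hne
      obtain ⟨t, ht⟩ := hne'
      refine le_csInf ⟨_, s, hs, t, ht, rfl⟩ ?_
      rintro _ ⟨s, hs, t, ht, rfl⟩
      exact hsep s hs t ht
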